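/- Let $M\subset\mathbb R^d$ be a compact, connected, embedded $C^4$ submanifold without boundary, let $\varepsilon>0$ and let $T=\{x\in\mathbb R^d:\operatorname{dist}(x,M)<\varepsilon\}$. Let $f_0\in C^3(T)$ and $f_1\in C^1(T)$ be real functions such that $\operatorname{argmin}_{x\in T} f_0(x)=M$ and such that the Hessian of $f_0$ in the directions normal to $M$ is uniformly positive definite on the tube: there is $\lambda>0$ with $D^2f_0(p+v)[w,w]\ge\lambda|w|^2$ for all $p\in M$ and all vectors $v,w$ normal to $M$ at $p$ with $|v|<\varepsilon$. For small $\theta>0$ let $b_\theta:\mathbb R^d\to\mathbb R^d$ be a locally bounded Borel drift with $$b_\theta(x)=-\nabla f_0(x)-\theta\,\nabla f_1(x)+\hat b(x,\theta),\qquad \sup_{x\in T}|\hat b(x,\theta)|=o(\theta)\quad(\theta\to0),$$ and let $\pi_\theta$ be the density of a stationary distribution of the SDE $$dx_t=\frac{b_\theta(x_t)}{\theta}\,dt+\sqrt2\,dW_t .$$ Assume the local WKB form: $\int_T\pi_\theta(x)\,dx\to1$ as $\theta\to0$, and on $T$ $$\pi_\theta(x)\propto \exp\!\Big(-\frac{V(x)}{\theta}\Big)\,c_\theta(x),$$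 where $V\in C^3(T)$, $c_0\in C^2(T)$ is positive, and $c_\theta\to c_0$ in $C^2(T)$ (that is, the derivatives up to order $2$ converge uniformly on $T$). Then there are constants $a\in\mathbb R$ and $C>0$ such that, for all $x\in T$, $$V(x)=f_0(x)+a,\qquad c_0(x)=C\exp(-f_1(x)).$$ (The form of $\pi_\theta$ determines $V$ only up to an additive constant; so $V=f_0$ when $V$ is normalized to have the same minimum on $T$ as $f_0$.) -/

import Mathlib

open Filter Topology MeasureTheory
open scoped NNReal ContDiff Gradient InnerProductSpace

noncomputable section

/-- `M` is an embedded `C^k` submanifold without boundary, of dimension `n`, of the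
finite-dimensional Euclidean space `E`: around each of its points there is a `C^k` diffeomorphism
between open subsets of `E` that straightens `M` to an `n`-dimensional linear subspace. -/
def IsEmbeddedSubmanifold {E : Type*} [NormedAddCommGroup E] [InnerProductSpace ℝ E]
    (k : WithTop ℕ∞) (n : ℕ) (M : Set E) : Prop :=
  ∀ p ∈ M, ∃ (φ : OpenPartialHomeomorph E E) (S : Submodule ℝ E),
    p ∈ φ.source ∧ Module.finrank ℝ S = n ∧
    ContDiffOn ℝ k φ φ.source ∧ ContDiffOn ℝ k φ.symm φ.target ∧
    ∀ x ∈ φ.source, x ∈ M ↔ φ x ∈ S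

/-- The tangent space of `M` at `p`, spanned by the velocities at `p` of curves in `M`. -/
def tangentSpaceAt {E : Type*} [NormedAddCommGroup E] [InnerProductSpace ℝ E]
    (M : Set E) (p : E) : Submodule ℝ E :=
  Submodule.span ℝ {w : E | ∃ γ : ℝ → E, γ 0 = p ∧ (∀ᶠ t in 𝓝 0, γ t ∈ M) ∧ HasDerivAt γ w 0}

/-- The normal space of `M` at `p`. -/
def normalSpaceAt {E : Type*} [NormedAddCommGroup E] [InnerProductSpace ℝ E]
    (M : Set E) (p : E) : Submodule ℝ E :=
  (tangentSpaceAt M p)ᗮ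

/-- In the tube of radius `ε` around `M`, whose points are written `p + v` with `p ∈ M` and
`v` normal to `M` at `p`, the Hessian of `f` in the normal directions has its smallest eigenvalue
bounded below by a positive constant. -/
def UniformlyConvexInNormalDirections {E : Type*} [NormedAddCommGroup E] [InnerProductSpace ℝ E]
    (M : Set E) (ε : ℝ) (f : E → ℝ) : Prop :=
  ∃ lam : ℝ, 0 < lam ∧ ∀ p ∈ M, ∀ v ∈ normalSpaceAt M p, ‖v‖ < ε →
    ∀ w ∈ normalSpaceAt M p, lam * ‖w‖ ^ 2 ≤ fderiv ℝ (fderiv ℝ f) (p + v) w w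

/-- The generator `Δ φ + ⟨β, ∇ φ⟩` of the diffusion `dx = β(x) dt + √2 dW`. -/
def generator {d : ℕ} (β : EuclideanSpace ℝ (Fin d) → EuclideanSpace ℝ (Fin d))
    (φ : EuclideanSpace ℝ (Fin d) → ℝ) (x : EuclideanSpace ℝ (Fin d)) : ℝ :=
  Laplacian.laplacian φ x + inner ℝ (β x) (∇ φ x)

/-- The process `X` with continuous paths is a weak solution of `dx = β(x) dt + √2 dW`, in the
sense of the Stroock–Varadhan martingale problem (for a locally bounded Borel drift `β`). -/
structure IsWeakSolution {d : ℕ} {Ω : Type*} {mΩ : MeasurableSpace Ω}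
    (β : EuclideanSpace ℝ (Fin d) → EuclideanSpace ℝ (Fin d))
    (ℱ : Filtration ℝ≥0 mΩ) (P : Measure Ω) (X : ℝ≥0 → Ω → EuclideanSpace ℝ (Fin d)) : Prop where
  adapted : StronglyAdapted ℱ X
  continuous_paths : ∀ x, Continuous fun t => X t x
  martingale : ∀ φ : EuclideanSpace ℝ (Fin d) → ℝ, ContDiff ℝ ∞ φ → HasCompactSupport φ →
    Martingale (fun (t : ℝ≥0) x =>
      φ (X t x) - φ (X 0 x) - ∫ s in (0 : ℝ)..(t : ℝ), generator β φ (X s.toNNReal x)) ℱ P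

/-- `p` is the density of a stationary distribution of `dx = β(x) dt + √2 dW`: it is the
Lebesgue density of the law, at all times, of some weak solution. -/
def IsStationaryDensity {d : ℕ} (β : EuclideanSpace ℝ (Fin d) → EuclideanSpace ℝ (Fin d))
    (p : EuclideanSpace ℝ (Fin d) → ℝ) : Prop :=
  Measurable p ∧ (∀ x, 0 ≤ p x) ∧
    ∃ (Ω : Type) (mΩ : MeasurableSpace Ω) (ℱ : Filtration ℝ≥0 mΩ) (P : Measure Ω)
      (X : ℝ≥0 → Ω → EuclideanSpace ℝ (Fin d)),
      IsProbabilityMeasure P ∧ IsWeakSolution β ℱ P X ∧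
      ∀ t, P.map (X t) = volume.withDensity fun x => ENNReal.ofReal (p x)

/-- `c θ → c₀` in `C^k(T)` as `θ ↓ 0` (`T` open): the functions are `C^k` on `T` and all
derivatives up to order `k` converge uniformly on `T`. -/
def TendstoInCk {E : Type*} [NormedAddCommGroup E] [InnerProductSpace ℝ E]
    (k : ℕ) (T : Set E) (c : ℝ → E → ℝ) (c₀ : E → ℝ) : Prop :=
  (∀ᶠ θ in 𝓝[>] (0 : ℝ), ContDiffOn ℝ k (c θ) T) ∧ ContDiffOn ℝ k c₀ T ∧
    ∀ j ≤ k, TendstoUniformlyOn (fun θ x => iteratedFDeriv ℝ j (c θ) x)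
      (fun x => iteratedFDeriv ℝ j c₀ x) (𝓝[>] (0 : ℝ)) T

/-- The local WKB ansatz for the densities `p θ` on the tube `T`, with exponent `V` and limiting
prefactor `c₀`. -/
structure HasLocalWKBForm {d : ℕ} (T : Set (EuclideanSpace ℝ (Fin d)))
    (p : ℝ → EuclideanSpace ℝ (Fin d) → ℝ) (V c₀ : EuclideanSpace ℝ (Fin d) → ℝ) : Prop where
  concentration : Tendsto (fun θ => ∫ x in T, p θ x) (𝓝[>] 0) (𝓝 1)
  exponent : ContDiffOn ℝ 3 V T
  prefactor_pos : ∀ x ∈ T, 0 < c₀ x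
  form : ∃ c : ℝ → EuclideanSpace ℝ (Fin d) → ℝ, TendstoInCk 2 T c c₀ ∧
    ∀ᶠ θ in 𝓝[>] (0 : ℝ), ∃ Z : ℝ, 0 < Z ∧ ∀ x ∈ T, p θ x = Z * (Real.exp (-V x / θ) * c θ x)

end

/-!
Write `T` for the tube and `U = V - f₀`. The proof extracts two orders in `θ` from the stationary
Fokker–Planck equation and then solves the resulting first order equations, using that `∇ f₀`
points away from `M`.

*From the SDE to a flux.* Taking expectations in the martingale problem for a stationary solution
gives `∫ p (generator φ) = 0` for smooth compactly supported `φ`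
(`IsStationaryDensity.integral_generator`). For `p = Z exp(-V/θ) c θ` an integration by parts on
`T` turns this into the weak equation `div (exp(-V/θ) (c θ ∇ U + θ R θ)) = 0`, tested with `C¹`
functions, where `R θ → -(c₀ ∇ f₁ + ∇ c₀)` locally uniformly (`setIntegral_fderiv_flux_eq_zero`,
`isDivergenceFreeFlux`). The drift is merely measurable, so the derivative has to stay on the test
function.

*Two orders.* Testing with `exp(V/θ) ψ` removes the exponential. The leading order is the eikonal
equation `⟨∇ V, ∇ U⟩ = 0`, the next one the transport equation
`⟨∇ V, -(c₀ ∇ f₁ + ∇ c₀)⟩ = ⟨∇ c₀, ∇ U⟩ + c₀ Δ U`.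

*The exponent.* On `M` the function `f₀` is minimal. Differentiating the eikonal equation twice
there gives `⟨H w, (H - A) w⟩ = 0` for all `w`, where `H` and `A` are the Hessians of `V` and
`f₀`, and the transport equation gives `tr (H - A) = 0`; since `A ≥ 0`, this forces `H = A`
(`fderiv_eq_zero_of_eikonal`). So `U` vanishes to second order along `M`, up to a constant, and
`∇ V` is as close to `∇ f₀` as needed in a thin tube; in particular it points outwards. Since `U` is
constant along `∇ V`, a maximum principle makes `U` constant on the thin tube
(`le_of_fderiv_gradient_eq_zero`), and a continuation argument extends this to `T`
(`eq_const_of_eikonal`).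

*The prefactor.* Now `∇ V = ∇ f₀`, and the transport equation says that `h = log c₀ + f₁` is
constant along `∇ f₀`; by the maximum principle it remains to see that `h` is constant on `M`.
This is where the nonlocal information enters: testing the flux with a cut-off of `h` by a
function of `f₀` bounds `∫ exp(-f₀/θ) c₀ ‖∇ h‖²` by a vanishing multiple of `∫ exp(-f₀/θ)`. If
`∇ h` were nonzero at a point of `M`, both integrals would be of order `θ` to half the codimension of
`M` (`exists_lintegral_exp_neg_le`, `exists_le_lintegral_exp_neg`,
`IsDivergenceFreeFlux.fderiv_eq_zero`).
-/

noncomputable section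

/-! ### The stationary Fokker–Planck equation in weak form -/

lemma inner_gradient_eq_fderiv {E : Type*} [NormedAddCommGroup E] [InnerProductSpace ℝ E]
    [CompleteSpace E] (φ : E → ℝ) (x v : E) : inner ℝ v (∇ φ x) = fderiv ℝ φ x v := by
  rw [real_inner_comm, gradient, InnerProductSpace.toDual_symm_apply]

section

variable {d : ℕ}

lemma generator_eq (β : EuclideanSpace ℝ (Fin d) → EuclideanSpace ℝ (Fin d))
    (φ : EuclideanSpace ℝ (Fin d) → ℝ) (x : EuclideanSpace ℝ (Fin d)) :
    generator β φ x = Laplacian.laplacian φ x + fderiv ℝ φ x (β x) := by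
  rw [generator, inner_gradient_eq_fderiv]

lemma fderiv_eq_zero_of_notMem_tsupport {E F : Type*} [NormedAddCommGroup E] [NormedSpace ℝ E]
    [NormedAddCommGroup F] [NormedSpace ℝ F] {φ : E → F} {x : E} (hx : x ∉ tsupport φ) :
    fderiv ℝ φ x = 0 := by
  by_contra h
  exact hx (support_fderiv_subset ℝ h)

lemma laplacian_eq_sum_fderiv {ι E : Type*} [Fintype ι] [NormedAddCommGroup E]
    [InnerProductSpace ℝ E] [FiniteDimensional ℝ E] (e : OrthonormalBasis ι ℝ E) (φ : E → ℝ)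
    (x : E) :
    Laplacian.laplacian φ x = ∑ i, fderiv ℝ (fderiv ℝ φ) x (e i) (e i) := by
  rw [InnerProductSpace.laplacian_eq_iteratedFDeriv_orthonormalBasis φ e]
  simp [iteratedFDeriv_two_apply]

lemma continuous_laplacian {φ : EuclideanSpace ℝ (Fin d) → ℝ} (hφ : ContDiff ℝ ∞ φ) :
    Continuous (Laplacian.laplacian φ) := by
  rw [show Laplacian.laplacian φ = _ from
    funext (laplacian_eq_sum_fderiv (EuclideanSpace.basisFun (Fin d) ℝ) φ)]
  have h2 : Continuous (fderiv ℝ (fderiv ℝ φ)) :=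
    ((hφ.fderiv_right (m := ∞) (by simp)).continuous_fderiv (by simp))
  fun_prop

lemma measurable_generator {β : EuclideanSpace ℝ (Fin d) → EuclideanSpace ℝ (Fin d)}
    (hβ : Measurable β) {φ : EuclideanSpace ℝ (Fin d) → ℝ} (hφ : ContDiff ℝ ∞ φ) :
    Measurable (generator β φ) := by
  have h1 : Continuous (∇ φ) :=
    (InnerProductSpace.toDual ℝ _).symm.continuous.comp (hφ.continuous_fderiv (by simp))
  exact (continuous_laplacian hφ).measurable.add (hβ.inner h1.measurable)

lemma laplacian_eq_zero_of_notMem_tsupport {φ : EuclideanSpace ℝ (Fin d) → ℝ}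
    {x : EuclideanSpace ℝ (Fin d)} (hx : x ∉ tsupport φ) : Laplacian.laplacian φ x = 0 := by
  rw [laplacian_eq_sum_fderiv (EuclideanSpace.basisFun (Fin d) ℝ)]
  have : x ∉ tsupport (fderiv ℝ φ) := fun h => hx (tsupport_fderiv_subset ℝ h)
  simp [fderiv_eq_zero_of_notMem_tsupport this]

lemma generator_bounded {β : EuclideanSpace ℝ (Fin d) → EuclideanSpace ℝ (Fin d)}
    (hloc : ∀ R : ℝ, ∃ B : ℝ, ∀ x, ‖x‖ ≤ R → ‖β x‖ ≤ B)
    {φ : EuclideanSpace ℝ (Fin d) → ℝ} (hφ : ContDiff ℝ ∞ φ) (hc : HasCompactSupport φ) :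
    ∃ C : ℝ, ∀ x, ‖generator β φ x‖ ≤ C := by
  have hK : IsCompact (tsupport φ) := hc
  obtain ⟨R, hR⟩ := hK.isBounded.exists_norm_le
  obtain ⟨B, hB⟩ := hloc R
  obtain ⟨C1, hC1⟩ := hK.exists_bound_of_continuousOn (continuous_laplacian hφ).continuousOn
  obtain ⟨C2, hC2⟩ := hK.exists_bound_of_continuousOn
    (hφ.continuous_fderiv (by simp)).continuousOn
  refine ⟨|C1| + |C2| * |B|, fun x => ?_⟩
  rw [generator_eq]
  by_cases hx : x ∈ tsupport φ
  · refine (norm_add_le _ _).trans (add_le_add ((hC1 x hx).trans (le_abs_self _)) ?_)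
    refine (ContinuousLinearMap.le_opNorm _ _).trans (mul_le_mul ((hC2 x hx).trans (le_abs_self _))
      ((hB x (hR x hx)).trans (le_abs_self _)) (norm_nonneg _) (abs_nonneg _))
  · rw [laplacian_eq_zero_of_notMem_tsupport hx, fderiv_eq_zero_of_notMem_tsupport hx]
    simp; positivity

/-- A stationary density annihilates the generator. The martingale has mean zero and the law of
`X t` does not depend on `t`, so the time average of `𝔼 (generator β φ (X s))` vanishes. -/
lemma IsStationaryDensity.integral_generator
    {β : EuclideanSpace ℝ (Fin d) → EuclideanSpace ℝ (Fin d)} {p : EuclideanSpace ℝ (Fin d) → ℝ}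
    (h : IsStationaryDensity β p) (hβ : Measurable β)
    (hloc : ∀ R : ℝ, ∃ B : ℝ, ∀ x, ‖x‖ ≤ R → ‖β x‖ ≤ B)
    {φ : EuclideanSpace ℝ (Fin d) → ℝ} (hφ : ContDiff ℝ ∞ φ) (hc : HasCompactSupport φ) :
    ∫ x, p x * generator β φ x = 0 := by
  obtain ⟨hpm, hp0, Ω, mΩ, ℱ, P, X, hP, hX, hlaw⟩ := h
  set L := generator β φ with hL
  have hLm : Measurable L := measurable_generator hβ hφ
  obtain ⟨C, hC⟩ := generator_bounded hloc hφ hc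
  have hXm : ∀ t, Measurable (X t) := fun t => ((hX.adapted t).mono (ℱ.le t)).measurable
  have hlawint : ∀ (g : EuclideanSpace ℝ (Fin d) → ℝ), Measurable g → ∀ t,
      ∫ o, g (X t o) ∂P = ∫ x, p x * g x := by
    intro g hg t
    rw [← integral_map (hXm t).aemeasurable hg.aestronglyMeasurable, hlaw t,
      integral_withDensity_eq_integral_toReal_smul hpm.ennreal_ofReal (by simp)]
    simp [ENNReal.toReal_ofReal (hp0 _)]
  have hjoint : Measurable (fun q : ℝ × Ω => X q.1.toNNReal q.2) := by
    have h1 : Measurable (Function.uncurry X) :=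
      measurable_uncurry_of_continuous_of_measurable hX.continuous_paths hXm
    exact h1.comp ((measurable_real_toNNReal.comp measurable_fst).prodMk measurable_snd)
  have hmart := hX.martingale φ hφ hc
  have hbdd : ∀ t, Integrable (fun o => φ (X t o)) P := by
    intro t
    obtain ⟨D, hD⟩ := hc.exists_bound_of_continuous hφ.continuous
    exact Integrable.of_bound (hφ.continuous.measurable.comp (hXm t)).aestronglyMeasurable D
      (ae_of_all _ fun o => hD _)
  have hF : Integrable (fun q : ℝ × Ω => L (X q.1.toNNReal q.2))
      ((volume.restrict (Set.Ioc (0 : ℝ) 1)).prod P) :=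
    Integrable.of_bound (hLm.comp hjoint).aestronglyMeasurable C (ae_of_all _ fun o => hC _)
  have e0 : 0 = ∫ o, ((φ (X 1 o) - φ (X 0 o)) -
      ∫ s in Set.Ioc (0 : ℝ) 1, L (X s.toNNReal o)) ∂P := by
    simpa [intervalIntegral.integral_of_le (zero_le_one' ℝ)] using
      hmart.setIntegral_eq (zero_le_one) (s := Set.univ) MeasurableSet.univ
  have e1 : ∫ o, (∫ s in Set.Ioc (0 : ℝ) 1, L (X s.toNNReal o)) ∂P = ∫ x, p x * L x := by
    rw [← integral_integral_swap (f := fun (s : ℝ) o => L (X s.toNNReal o)) hF]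
    simp [hlawint L hLm]
  rw [integral_sub (f := fun o => φ (X 1 o) - φ (X 0 o))
      (g := fun o => ∫ s in Set.Ioc (0 : ℝ) 1, L (X s.toNNReal o))
      ((hbdd 1).sub (hbdd 0)) hF.integral_prod_right,
    integral_sub (hbdd 1) (hbdd 0), hlawint φ hφ.continuous.measurable,
    hlawint φ hφ.continuous.measurable, e1] at e0
  linarith

end

/-! ### Mollification and integration by parts on an open set -/

section

variable {E : Type*} [NormedAddCommGroup E] [InnerProductSpace ℝ E] [FiniteDimensional ℝ E]
  [MeasurableSpace E] [BorelSpace E] {T : Set E}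

/-- A compactly supported `C¹` function is approximated in `C¹` by smooth functions supported in a
fixed compact neighbourhood of its support. -/
lemma exists_contDiff_approx_fderiv (hT : IsOpen T) {g : E → ℝ} (hg : ContDiff ℝ 1 g)
    (hc : HasCompactSupport g) (hgT : tsupport g ⊆ T) :
    ∃ K, IsCompact K ∧ K ⊆ T ∧ tsupport g ⊆ K ∧ ∀ η > 0, ∃ u : E → ℝ, ContDiff ℝ ∞ u ∧
      tsupport u ⊆ K ∧ ∀ x, ‖fderiv ℝ u x - fderiv ℝ g x‖ ≤ η := by
  obtain ⟨δ, hδ, hδT⟩ := hc.isCompact.exists_cthickening_subset_open hT hgT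
  refine ⟨Metric.cthickening δ (tsupport g), hc.isCompact.cthickening, hδT,
    Metric.self_subset_cthickening _, fun η hη => ?_⟩
  have hdc : Continuous (fderiv ℝ g) := hg.continuous_fderiv (by simp)
  have huc : UniformContinuous (fderiv ℝ g) :=
    (hc.fderiv ℝ).uniformContinuous_of_continuous hdc
  obtain ⟨r, hr, hru⟩ := Metric.uniformContinuous_iff.1 huc η hη
  let φ : ContDiffBump (0 : E) := ⟨min r δ / 2, min r δ, by positivity, by
    have : 0 < min r δ := by positivity
    linarith⟩
  have hφc : HasCompactSupport (φ.normed volume) := φ.hasCompactSupport_normed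
  set u : E → ℝ := convolution (φ.normed volume) g (ContinuousLinearMap.lsmul ℝ ℝ) volume with hu
  have hgl : LocallyIntegrable g volume := hg.continuous.locallyIntegrable
  have hsupp : tsupport u ⊆ Metric.cthickening δ (tsupport g) := by
    refine closure_minimal ?_ Metric.isClosed_cthickening
    refine (support_convolution_subset _).trans ?_
    rintro _ ⟨a, ha, b, hb, rfl⟩
    rw [φ.support_normed_eq] at ha
    refine Metric.mem_cthickening_of_dist_le _ b δ _ (subset_tsupport g hb) ?_
    rw [dist_eq_norm, add_sub_cancel_right]
    exact (mem_ball_zero_iff.1 ha).le.trans (min_le_right _ _)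
  refine ⟨u, hφc.contDiff_convolution_left _ φ.contDiff_normed hgl, hsupp, fun x => ?_⟩
  have hd : HasFDerivAt u (convolution (φ.normed volume) (fderiv ℝ g)
      (ContinuousLinearMap.lsmul ℝ ℝ) volume x) x := by
    have := hc.hasFDerivAt_convolution_right (ContinuousLinearMap.lsmul ℝ ℝ) (μ := volume)
      (φ.continuous_normed (μ := volume)).locallyIntegrable hg x
    have hL : ContinuousLinearMap.precompR E (ContinuousLinearMap.lsmul ℝ ℝ (E := ℝ)) =
        ContinuousLinearMap.lsmul ℝ ℝ (E := E →L[ℝ] ℝ) := by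
      ext; simp
    rwa [hL] at this
  rw [hd.fderiv, ← dist_eq_norm]
  refine φ.dist_normed_convolution_le hdc.aestronglyMeasurable fun y hy => (hru ?_).le
  exact (Metric.mem_ball.1 hy).trans_le (min_le_left _ _)

/-- A locally integrable field that is weakly divergence free when tested against smooth functions
is so when tested against `C¹` functions. -/
lemma setIntegral_fderiv_apply_eq_zero (hT : IsOpen T) {J : E → E}
    (hJ : ∀ K ⊆ T, IsCompact K → IntegrableOn J K)
    (h : ∀ φ : E → ℝ, ContDiff ℝ ∞ φ → HasCompactSupport φ → tsupport φ ⊆ T →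
      ∫ x in T, fderiv ℝ φ x (J x) = 0)
    {g : E → ℝ} (hg : ContDiff ℝ 1 g) (hc : HasCompactSupport g) (hgT : tsupport g ⊆ T) :
    ∫ x in T, fderiv ℝ g x (J x) = 0 := by
  obtain ⟨K, hK, hKT, hgK, happ⟩ := exists_contDiff_approx_fderiv hT hg hc hgT
  have key : ∀ φ : E → ℝ, tsupport φ ⊆ K →
      ∫ x in T, fderiv ℝ φ x (J x) = ∫ x in K, fderiv ℝ φ x (J x) := by
    intro φ hφ
    refine (setIntegral_eq_of_subset_of_forall_sdiff_eq_zero hT.measurableSet hKT fun x hx => ?_)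
    rw [fderiv_eq_zero_of_notMem_tsupport fun h => hx.2 (hφ h)]; rfl
  have hint : ∀ φ : E → ℝ, ContDiff ℝ 1 φ → IntegrableOn (fun x => fderiv ℝ φ x (J x)) K := by
    intro φ hφ
    have hφc := hφ.continuous_fderiv (by simp)
    obtain ⟨C, hC⟩ := hK.exists_bound_of_continuousOn hφc.continuousOn
    refine Integrable.mono' ((hJ K hKT hK).norm.const_mul C) ?_ ?_
    · exact (ContinuousLinearMap.apply ℝ ℝ (E := E)).flip.aestronglyMeasurable_comp₂
        hφc.aestronglyMeasurable (hJ K hKT hK).aestronglyMeasurable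
    · filter_upwards [ae_restrict_mem hK.measurableSet] with x hx
      exact (ContinuousLinearMap.le_opNorm _ _).trans
        (mul_le_mul_of_nonneg_right (hC x hx) (norm_nonneg _))
  set I := ∫ x in K, ‖J x‖
  have hI : 0 ≤ I := integral_nonneg fun x => norm_nonneg _
  have bound : ∀ η > 0, |∫ x in K, fderiv ℝ g x (J x)| ≤ η * I := by
    intro η hη
    obtain ⟨u, hu, huK, hug⟩ := happ η hη
    have h0 := h u hu (hK.of_isClosed_subset (isClosed_tsupport u) huK) (huK.trans hKT)
    rw [key u huK] at h0
    rw [← sub_zero (∫ x in K, fderiv ℝ g x (J x)), ← h0,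
      ← integral_sub (hint g hg) (hint u (hu.of_le (by exact_mod_cast le_top))),
      ← integral_const_mul]
    refine (norm_integral_le_integral_norm _).trans (integral_mono_of_nonneg
      (ae_of_all _ fun x => norm_nonneg (_ : ℝ)) ((hJ K hKT hK).norm.const_mul η)
      (ae_of_all _ fun x => ?_))
    change ‖fderiv ℝ g x (J x) - fderiv ℝ u x (J x)‖ ≤ η * ‖J x‖
    rw [← sub_apply]
    refine (ContinuousLinearMap.le_opNorm _ _).trans (mul_le_mul_of_nonneg_right ?_ (norm_nonneg _))
    rw [norm_sub_rev]; exact hug x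
  rw [key g hgK]
  refine abs_nonpos_iff.1 (le_of_forall_pos_le_add fun ε hε => ?_)
  have := bound (ε / (I + 1)) (by positivity)
  refine this.trans ?_
  rw [zero_add, div_mul_eq_mul_div, div_le_iff₀ (by positivity)]
  nlinarith

/-- Integration by parts in the direction `v`, for `u` only defined near the support of `w`. -/
lemma setIntegral_mul_fderiv (hT : IsOpen T) {u w : E → ℝ} (hu : ContDiffOn ℝ 1 u T)
    (hw : ContDiff ℝ 1 w) (hc : HasCompactSupport w) (hwT : tsupport w ⊆ T) (v : E) :
    ∫ x in T, u x * fderiv ℝ w x v = -∫ x in T, fderiv ℝ u x v * w x := by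
  have e1 : ∀ F : E → ℝ, (∀ x ∉ tsupport w, F x = 0) → ∫ x in T, F x = ∫ x, F x := fun F hF =>
    setIntegral_eq_integral_of_forall_compl_eq_zero fun x hx => hF x fun h => hx (hwT h)
  have z1 : ∀ x ∉ tsupport w, w x = 0 := fun x hx => image_eq_zero_of_notMem_tsupport hx
  have z2 : ∀ x ∉ tsupport w, fderiv ℝ w x v = 0 := fun x hx => by
    rw [fderiv_eq_zero_of_notMem_tsupport hx]; rfl
  rw [e1 _ fun x hx => by rw [z2 x hx, mul_zero], e1 _ fun x hx => by rw [z1 x hx, mul_zero]]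
  have hint : ∀ F : E → ℝ, ContinuousOn F T → (∀ x ∉ tsupport w, F x = 0) → Integrable F := by
    intro F hF h0
    have : IntegrableOn F (tsupport w) := (hF.mono hwT).integrableOn_compact hc
    refine this.integrable_of_forall_notMem_eq_zero h0
  have cw : Continuous fun x => fderiv ℝ w x v :=
    (hw.continuous_fderiv (by simp)).clm_apply continuous_const
  have cu : ContinuousOn (fun x => fderiv ℝ u x v) T :=
    (hu.continuousOn_fderiv_of_isOpen hT le_rfl).clm_apply continuousOn_const
  refine integral_mul_fderiv_eq_neg_fderiv_mul_of_integrable ?_ ?_ ?_ ?_ ?_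
  · exact hint _ (cu.mul hw.continuous.continuousOn) fun x hx => by rw [z1 x hx, mul_zero]
  · exact hint _ (hu.continuousOn.mul cw.continuousOn) fun x hx => by rw [z2 x hx, mul_zero]
  · exact hint _ (hu.continuousOn.mul hw.continuous.continuousOn) fun x hx => by
      rw [z1 x hx, mul_zero]
  · exact fun x hx => (hu.differentiableOn (by simp)).differentiableAt (hT.mem_nhds (hwT hx))
  · exact fun x _ => (hw.differentiable (by simp)).differentiableAt

lemma eqOn_zero_of_setIntegral_mul_eq_zero (hT : IsOpen T) {F : E → ℝ} (hF : ContinuousOn F T)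
    (h : ∀ ψ : E → ℝ, ContDiff ℝ ∞ ψ → HasCompactSupport ψ → tsupport ψ ⊆ T →
      ∫ x in T, ψ x * F x = 0) : ∀ x ∈ T, F x = 0 := by
  have hae : ∀ᵐ x ∂(volume : Measure E), x ∈ T → F x = 0 := by
    refine hT.ae_eq_zero_of_integral_contDiff_smul_eq_zero
      (hF.locallyIntegrableOn hT.measurableSet) fun g hg hc hgT => ?_
    rw [← h g hg hc hgT]
    refine (setIntegral_eq_integral_of_forall_compl_eq_zero fun x hx => ?_).symm
    rw [image_eq_zero_of_notMem_tsupport fun h => hx (hgT h), zero_smul]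
  have := Measure.eqOn_open_of_ae_eq (μ := (volume : Measure E)) (f := F) (g := fun _ => 0)
    ((ae_restrict_iff' hT.measurableSet).2 hae) hT hF continuousOn_const
  exact fun x hx => this hx

end

/-! ### The flux of the WKB density -/

lemma continuousOn_gradient {E : Type*} [NormedAddCommGroup E] [InnerProductSpace ℝ E]
    [CompleteSpace E] {T : Set E} (hT : IsOpen T) {f : E → ℝ} (hf : ContDiffOn ℝ 1 f T) :
    ContinuousOn (∇ f) T :=
  (InnerProductSpace.toDual ℝ E).symm.continuous.comp_continuousOn
    (hf.continuousOn_fderiv_of_isOpen hT le_rfl)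

lemma fderiv_apply_eq_sum {E : Type*} [NormedAddCommGroup E] [InnerProductSpace ℝ E]
    {ι : Type*} [Fintype ι] (e : OrthonormalBasis ι ℝ E) (φ : E → ℝ) (x v : E) :
    fderiv ℝ φ x v = ∑ i, inner ℝ (e i) v * fderiv ℝ φ x (e i) := by
  conv_lhs => rw [← e.sum_repr' v]
  simp

section

variable {E : Type*} [NormedAddCommGroup E] [InnerProductSpace ℝ E] [FiniteDimensional ℝ E]
  [MeasurableSpace E] [BorelSpace E] {T : Set E}

lemma integrableOn_of_continuousOn_of_tsupport {w F : E → ℝ}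
    (hc : HasCompactSupport w) (hwT : tsupport w ⊆ T) (hF : ContinuousOn F T)
    (h0 : ∀ x ∉ tsupport w, F x = 0) : IntegrableOn F T := by
  have : IntegrableOn F (tsupport w) := (hF.mono hwT).integrableOn_compact hc
  exact (this.integrable_of_forall_notMem_eq_zero h0).integrableOn

lemma setIntegral_mul_laplacian (hT : IsOpen T) {q φ : E → ℝ} (hq : ContDiffOn ℝ 1 q T)
    (hφ : ContDiff ℝ ∞ φ) (hc : HasCompactSupport φ) (hφT : tsupport φ ⊆ T) :
    ∫ x in T, q x * Laplacian.laplacian φ x = -∫ x in T, fderiv ℝ φ x (∇ q x) := by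
  set e := stdOrthonormalBasis ℝ E
  have hφ1 : ∀ i, ContDiff ℝ ∞ fun x => fderiv ℝ φ x (e i) := fun i =>
    (hφ.fderiv_right (m := ∞) (by simp)).clm_apply contDiff_const
  have hs : ∀ i, tsupport (fun x => fderiv ℝ φ x (e i)) ⊆ tsupport φ := fun i =>
    closure_minimal (fun x hx => by
      by_contra h
      exact hx (by simp [fderiv_eq_zero_of_notMem_tsupport h])) (isClosed_tsupport φ)
  have hci : ∀ i, HasCompactSupport fun x => fderiv ℝ φ x (e i) := fun i =>
    hc.of_isClosed_subset (isClosed_tsupport _) (hs i)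
  have h2 : ∀ i x, fderiv ℝ (fun x => fderiv ℝ φ x (e i)) x (e i) =
      fderiv ℝ (fderiv ℝ φ) x (e i) (e i) := fun i x => by
    rw [fderiv_clm_apply ((hφ.fderiv_right (m := ∞) (by simp)).differentiable
      (by simp)).differentiableAt (differentiableAt_const _)]
    simp
  have key : ∀ i, ∫ x in T, q x * fderiv ℝ (fderiv ℝ φ) x (e i) (e i) =
      -∫ x in T, fderiv ℝ q x (e i) * fderiv ℝ φ x (e i) := fun i => by
    rw [← setIntegral_mul_fderiv hT hq ((hφ1 i).of_le (by exact_mod_cast le_top)) (hci i)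
      ((hs i).trans hφT) (e i)]
    simp_rw [h2]
  simp_rw [laplacian_eq_sum_fderiv e, fderiv_apply_eq_sum e φ _ (∇ q _), inner_gradient_eq_fderiv,
    Finset.mul_sum]
  rw [integral_finsetSum, integral_finsetSum, ← Finset.sum_neg_distrib]
  · exact Finset.sum_congr rfl fun i _ => key i
  · intro i _
    refine integrableOn_of_continuousOn_of_tsupport hc hφT ?_ fun x hx => by
      simp [fderiv_eq_zero_of_notMem_tsupport hx]
    exact ((hq.continuousOn_fderiv_of_isOpen hT le_rfl).clm_apply continuousOn_const).mul
      (hφ1 i).continuous.continuousOn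
  · intro i _
    refine integrableOn_of_continuousOn_of_tsupport hc hφT ?_ fun x hx => ?_
    · simp_rw [← h2]
      exact hq.continuousOn.mul (((hφ1 i).continuous_fderiv (by simp)).clm_apply
        continuous_const).continuousOn
    · have : x ∉ tsupport (fderiv ℝ φ) := fun h => hx (tsupport_fderiv_subset ℝ h)
      simp [fderiv_eq_zero_of_notMem_tsupport this]

/-- Green's identity on `T` for the field `q ∇ U` and a compactly supported test function. -/
lemma setIntegral_mul_fderiv_gradient (hT : IsOpen T) {q U ψ : E → ℝ} (hq : ContDiffOn ℝ 1 q T)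
    (hU : ContDiffOn ℝ 2 U T) (hψ : ContDiff ℝ 1 ψ) (hc : HasCompactSupport ψ)
    (hψT : tsupport ψ ⊆ T) :
    ∫ x in T, q x * fderiv ℝ ψ x (∇ U x) =
      -∫ x in T, ψ x * (fderiv ℝ q x (∇ U x) + q x * Laplacian.laplacian U x) := by
  set e := stdOrthonormalBasis ℝ E
  have hU' : ContDiffOn ℝ 1 (fderiv ℝ U) T := hU.fderiv_of_isOpen hT (by norm_num)
  have hUi : ∀ i, ContDiffOn ℝ 1 (fun x => fderiv ℝ U x (e i)) T := fun i =>
    hU'.clm_apply contDiffOn_const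
  have hqU : ∀ i, ContDiffOn ℝ 1 (fun x => q x * fderiv ℝ U x (e i)) T := fun i => hq.mul (hUi i)
  have hd : ∀ i, ∀ x ∈ T, fderiv ℝ (fun x => q x * fderiv ℝ U x (e i)) x (e i) =
      fderiv ℝ q x (e i) * fderiv ℝ U x (e i) + q x * fderiv ℝ (fderiv ℝ U) x (e i) (e i) := by
    intro i x hx
    have d1 := (hq.differentiableOn (by simp)).differentiableAt (hT.mem_nhds hx)
    have d2 := (hU'.differentiableOn (by simp)).differentiableAt (hT.mem_nhds hx)
    rw [fderiv_fun_mul d1 (d2.clm_apply (differentiableAt_const _)),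
      fderiv_clm_apply d2 (differentiableAt_const _)]
    simp; ring
  simp_rw [laplacian_eq_sum_fderiv e, fderiv_apply_eq_sum e _ _ (∇ U _), inner_gradient_eq_fderiv,
    Finset.mul_sum]
  have hcψ : ∀ i, Continuous fun x => fderiv ℝ ψ x (e i) := fun i =>
    (hψ.continuous_fderiv (by simp)).clm_apply continuous_const
  rw [integral_finsetSum]
  · have e1 : ∀ i, ∫ x in T, q x * (fderiv ℝ U x (e i) * fderiv ℝ ψ x (e i)) =
        -∫ x in T, fderiv ℝ (fun x => q x * fderiv ℝ U x (e i)) x (e i) * ψ x := fun i => by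
      rw [← setIntegral_mul_fderiv hT (hqU i) hψ hc hψT (e i)]
      simp_rw [mul_assoc]
    simp_rw [e1]
    rw [Finset.sum_neg_distrib, ← integral_finsetSum]
    · congr 1
      refine setIntegral_congr_fun hT.measurableSet fun x hx => ?_
      rw [← Finset.sum_add_distrib, Finset.mul_sum]
      exact Finset.sum_congr rfl fun i _ => by rw [hd i x hx]; ring
    · intro i _
      refine integrableOn_of_continuousOn_of_tsupport hc hψT ?_ fun x hx => by
        simp [image_eq_zero_of_notMem_tsupport hx]
      exact (((hqU i).continuousOn_fderiv_of_isOpen hT le_rfl).clm_apply continuousOn_const).mul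
        hψ.continuous.continuousOn
  · intro i _
    refine integrableOn_of_continuousOn_of_tsupport hc hψT ?_ fun x hx => by
      simp [fderiv_eq_zero_of_notMem_tsupport hx]
    exact hq.continuousOn.mul ((hUi i).continuousOn.mul (hcψ i).continuousOn)

end

/-- The flux of a stationary density of WKB form `Z exp(-V/θ) c` is weakly divergence free. -/
lemma setIntegral_fderiv_flux_eq_zero {d : ℕ} {T : Set (EuclideanSpace ℝ (Fin d))} (hT : IsOpen T)
    {θ Z : ℝ} (hθ : 0 < θ) (hZ : 0 < Z) {V c p : EuclideanSpace ℝ (Fin d) → ℝ}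
    {b : EuclideanSpace ℝ (Fin d) → EuclideanSpace ℝ (Fin d)}
    (hV : ContDiffOn ℝ 1 V T) (hc : ContDiffOn ℝ 1 c T)
    (hbm : Measurable b) (hbloc : ∀ R : ℝ, ∃ B : ℝ, ∀ x, ‖x‖ ≤ R → ‖b x‖ ≤ B)
    (hp : IsStationaryDensity (fun x => θ⁻¹ • b x) p)
    (hform : ∀ x ∈ T, p x = Z * (Real.exp (-V x / θ) * c x))
    {g : EuclideanSpace ℝ (Fin d) → ℝ} (hg : ContDiff ℝ 1 g) (hgc : HasCompactSupport g)
    (hgT : tsupport g ⊆ T) :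
    ∫ x in T, fderiv ℝ g x (Real.exp (-V x / θ) • (c x • (∇ V x + b x) - θ • ∇ c x)) = 0 := by
  set q : EuclideanSpace ℝ (Fin d) → ℝ := fun x => Real.exp (-V x / θ) * c x with hqdef
  have hexp : ContDiffOn ℝ 1 (fun x => Real.exp (-V x / θ)) T := (hV.neg.div_const θ).exp
  have hq : ContDiffOn ℝ 1 q T := hexp.mul hc
  have hgradq : ∀ x ∈ T, ∇ q x = Real.exp (-V x / θ) • (∇ c x - (θ⁻¹ * c x) • ∇ V x) := by
    intro x hx
    have dV := (hV.differentiableOn (by simp)).differentiableAt (hT.mem_nhds hx)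
    have dc := (hc.differentiableOn (by simp)).differentiableAt (hT.mem_nhds hx)
    have h1 : HasFDerivAt q _ x := ((dV.hasFDerivAt.neg.mul_const θ⁻¹).exp).mul dc.hasFDerivAt
    rw [gradient, h1.fderiv]
    simp only [gradient, map_add, map_smul, map_neg, smul_sub, smul_smul, Pi.neg_apply]
    simp only [div_eq_mul_inv]
    module
  refine setIntegral_fderiv_apply_eq_zero hT ?_ ?_ hg hgc hgT
  · intro K hKT hK
    obtain ⟨R, hR⟩ := hK.isBounded.exists_norm_le
    obtain ⟨B, hB⟩ := hbloc R
    have hbK : IntegrableOn b K := by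
      refine IntegrableOn.of_bound hK.measure_lt_top hbm.aestronglyMeasurable B ?_
      filter_upwards [ae_restrict_mem hK.measurableSet] with x hx using hB x (hR x hx)
    have i1 : IntegrableOn (fun x => (Real.exp (-V x / θ) * c x) • b x) K :=
      hbK.continuousOn_smul (hq.continuousOn.mono hKT) hK
    have i2 : IntegrableOn (fun x => (Real.exp (-V x / θ)) • (c x • ∇ V x - θ • ∇ c x)) K := by
      refine ContinuousOn.integrableOn_compact hK (ContinuousOn.mono ?_ hKT)
      exact hexp.continuousOn.smul ((hc.continuousOn.smul (continuousOn_gradient hT hV)).sub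
        ((continuousOn_gradient hT hc).const_smul θ))
    refine (i1.add i2).congr (ae_of_all _ fun x => ?_)
    simp only [Pi.add_apply]
    module
  · intro φ hφ hφc hφT
    have h0 := hp.integral_generator (by fun_prop) (fun R => by
      obtain ⟨B, hB⟩ := hbloc R
      refine ⟨|θ⁻¹| * B, fun x hx => ?_⟩
      rw [norm_smul]
      exact mul_le_mul_of_nonneg_left (hB x hx) (abs_nonneg _)) hφ hφc
    have hz : ∀ x ∉ tsupport φ, generator (fun x => θ⁻¹ • b x) φ x = 0 := fun x hx => by
      rw [generator_eq, laplacian_eq_zero_of_notMem_tsupport hx,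
        fderiv_eq_zero_of_notMem_tsupport hx]; simp
    rw [← setIntegral_eq_integral_of_forall_compl_eq_zero (s := T)
      (fun x hx => by rw [hz x fun h => hx (hφT h), mul_zero])] at h0
    have hφd : Continuous (fderiv ℝ φ) := hφ.continuous_fderiv (by simp)
    obtain ⟨R, hR⟩ := hφc.isCompact.isBounded.exists_norm_le
    obtain ⟨B, hB⟩ := hbloc R
    have ib : IntegrableOn (fun x => q x * fderiv ℝ φ x (b x)) T := by
      have : IntegrableOn (fun x => q x * fderiv ℝ φ x (b x)) (tsupport φ) := by
        obtain ⟨C1, hC1⟩ := IsCompact.exists_bound_of_continuousOn hφc hφd.continuousOn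
        have i0 : IntegrableOn (fun x => fderiv ℝ φ x (b x)) (tsupport φ) := by
          refine IntegrableOn.of_bound hφc.isCompact.measure_lt_top ?_ (C1 * B) ?_
          · exact (ContinuousLinearMap.apply ℝ ℝ
              (E := EuclideanSpace ℝ (Fin d))).flip.aestronglyMeasurable_comp₂
              hφd.aestronglyMeasurable hbm.aestronglyMeasurable
          · filter_upwards [ae_restrict_mem hφc.isCompact.measurableSet] with x hx
            exact (ContinuousLinearMap.le_opNorm _ _).trans (mul_le_mul (hC1 x hx)
              (hB x (hR x hx)) (norm_nonneg _) ((norm_nonneg _).trans (hC1 x hx)))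
        exact i0.continuousOn_mul (hq.continuousOn.mono hφT) hφc
      exact (this.integrable_of_forall_notMem_eq_zero fun x hx => by
        simp [fderiv_eq_zero_of_notMem_tsupport hx]).integrableOn
    have iL : IntegrableOn (fun x => q x * Laplacian.laplacian φ x) T :=
      integrableOn_of_continuousOn_of_tsupport hφc hφT
        (hq.continuousOn.mul (continuous_laplacian hφ).continuousOn)
        fun x hx => by rw [laplacian_eq_zero_of_notMem_tsupport hx, mul_zero]
    have iq : IntegrableOn (fun x => fderiv ℝ φ x (∇ q x)) T :=
      integrableOn_of_continuousOn_of_tsupport hφc hφT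
        (hφd.continuousOn.clm_apply (continuousOn_gradient hT hq))
        fun x hx => by simp [fderiv_eq_zero_of_notMem_tsupport hx]
    have e1 : ∫ x in T, p x * generator (fun x => θ⁻¹ • b x) φ x =
        Z * (∫ x in T, q x * Laplacian.laplacian φ x) +
          Z * (θ⁻¹ * ∫ x in T, q x * fderiv ℝ φ x (b x)) := by
      rw [← integral_const_mul, ← integral_const_mul, ← integral_const_mul,
        ← integral_add (iL.const_mul Z) ((ib.const_mul θ⁻¹).const_mul Z)]
      refine setIntegral_congr_fun hT.measurableSet fun x hx => ?_
      simp only [hform x hx, generator_eq, map_smul, smul_eq_mul, hqdef]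
      ring
    rw [e1, setIntegral_mul_laplacian hT hq hφ hφc hφT] at h0
    have e2 : ∫ x in T, fderiv ℝ φ x (Real.exp (-V x / θ) • (c x • (∇ V x + b x) - θ • ∇ c x)) =
        (∫ x in T, q x * fderiv ℝ φ x (b x)) - θ * ∫ x in T, fderiv ℝ φ x (∇ q x) := by
      rw [← integral_const_mul, ← integral_sub ib (iq.const_mul θ)]
      refine setIntegral_congr_fun hT.measurableSet fun x hx => ?_
      rw [hgradq x hx]
      simp only [map_smul, smul_eq_mul, map_sub, map_add, hqdef]
      field_simp
      ring
    rw [e2]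
    have hθ' : θ * θ⁻¹ = 1 := mul_inv_cancel₀ hθ.ne'
    refine (mul_eq_zero_iff_left (mul_pos hZ (inv_pos.2 hθ)).ne').1 ?_
    rw [← h0]
    linear_combination (-Z * ∫ x in T, fderiv ℝ φ x (∇ q x)) * hθ'

/-! ### The eikonal and transport equations -/

lemma contDiff_mul_of_tsupport {E : Type*} [NormedAddCommGroup E] [NormedSpace ℝ E] {T : Set E}
    {n : ℕ∞} (hT : IsOpen T) {u w : E → ℝ} (hu : ContDiffOn ℝ n u T)
    (hw : ContDiff ℝ n w) (hwT : tsupport w ⊆ T) : ContDiff ℝ n fun x => u x * w x := by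
  rw [contDiff_iff_contDiffAt]
  intro x
  by_cases hx : x ∈ tsupport w
  · exact (hu.contDiffAt (hT.mem_nhds (hwT hx))).mul hw.contDiffAt
  · have : (fun x => u x * w x) =ᶠ[𝓝 x] fun _ => 0 := by
      filter_upwards [notMem_tsupport_iff_eventuallyEq.1 hx] with y hy
      rw [hy]; simp
    exact contDiffAt_const.congr_of_eventuallyEq this

section

variable {E : Type*} [NormedAddCommGroup E] [InnerProductSpace ℝ E] [FiniteDimensional ℝ E]
  [MeasurableSpace E] [BorelSpace E] {T : Set E}

/-- Integrals against a compactly supported continuous covector field pass to locally uniform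
limits. -/
lemma tendsto_setIntegral_clm_apply {F : Type*} [NormedAddCommGroup F] [NormedSpace ℝ F]
    (hT : IsOpen T) {K : Set E} (hK : IsCompact K) (hKT : K ⊆ T)
    {A : E → F →L[ℝ] ℝ} (hA : ContinuousOn A T) (hA0 : ∀ x ∉ K, A x = 0)
    {r : ℝ → E → F} {r₀ : E → F} (hr₀ : ContinuousOn r₀ T)
    (hu : TendstoUniformlyOn r r₀ (𝓝[>] 0) K)
    (hm : ∀ᶠ θ in 𝓝[>] (0 : ℝ), AEStronglyMeasurable (r θ) (volume.restrict T)) :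
    (∀ᶠ θ in 𝓝[>] (0 : ℝ), IntegrableOn (fun x => A x (r θ x)) T) ∧
    Tendsto (fun θ => ∫ x in T, A x (r θ x)) (𝓝[>] 0) (𝓝 (∫ x in T, A x (r₀ x))) := by
  obtain ⟨C, hC⟩ := hK.exists_bound_of_continuousOn (hA.mono hKT)
  obtain ⟨D, hD⟩ := hK.exists_bound_of_continuousOn (hr₀.mono hKT)
  have hb : ∀ᶠ θ in 𝓝[>] (0 : ℝ), ∀ x ∈ T,
      ‖A x (r θ x)‖ ≤ K.indicator (fun _ => |C| * (D + 1)) x := by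
    filter_upwards [Metric.tendstoUniformlyOn_iff.1 hu 1 one_pos] with θ hθ x _
    by_cases hx : x ∈ K
    · rw [Set.indicator_of_mem hx]
      have h1 : ‖r θ x‖ ≤ D + 1 := by
        have := hθ x hx
        rw [dist_eq_norm, norm_sub_rev] at this
        have h2 := norm_add_le (r θ x - r₀ x) (r₀ x)
        rw [sub_add_cancel] at h2
        linarith [hD x hx]
      exact (ContinuousLinearMap.le_opNorm _ _).trans
        (mul_le_mul ((hC x hx).trans (le_abs_self _)) h1 (norm_nonneg _) (abs_nonneg _))
    · rw [Set.indicator_of_notMem hx, hA0 x hx]; simp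
  have hmeas : ∀ᶠ θ in 𝓝[>] (0 : ℝ),
      AEStronglyMeasurable (fun x => A x (r θ x)) (volume.restrict T) := by
    filter_upwards [hm] with θ hθ
    exact (ContinuousLinearMap.apply ℝ ℝ (E := F)).flip.aestronglyMeasurable_comp₂
      (hA.aestronglyMeasurable hT.measurableSet) hθ
  have hint : Integrable (K.indicator fun _ => |C| * (D + 1)) (volume.restrict T) :=
    ((integrable_indicator_iff hK.measurableSet).2
      (continuousOn_const.integrableOn_compact hK)).integrableOn
  have hae : ∀ {P : E → Prop}, (∀ x ∈ T, P x) → ∀ᵐ x ∂(volume.restrict T), P x := fun h => by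
    filter_upwards [ae_restrict_mem hT.measurableSet] with x hx using h x hx
  refine ⟨?_, ?_⟩
  · filter_upwards [hb, hmeas] with θ h1 h2 using hint.mono' h2 (hae h1)
  · refine tendsto_integral_filter_of_dominated_convergence _ hmeas
      (hb.mono fun θ h => hae h) hint (hae fun x _ => ?_)
    by_cases hx : x ∈ K
    · exact ((A x).continuous.tendsto _).comp (hu.tendsto_at hx)
    · simp [hA0 x hx]

/-- The fields `exp(-V/θ) (c θ X + θ R θ)` are weakly divergence free on `T` for small `θ`, where
`c θ → c₀` and `R θ → R₀` locally uniformly on `T`. This is what stationarity says about a density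
of WKB form, with `X = ∇ V - ∇ f₀`. -/
structure IsDivergenceFreeFlux (T : Set E) (V : E → ℝ) (X : E → E) (c : ℝ → E → ℝ) (c₀ : E → ℝ)
    (R : ℝ → E → E) (R₀ : E → E) : Prop where
  isOpen : IsOpen T
  exponent : ContDiffOn ℝ 1 V T
  field : ContinuousOn X T
  prefactor : ContinuousOn c₀ T
  remainder : ContinuousOn R₀ T
  prefactor_tendsto : ∀ K ⊆ T, IsCompact K → TendstoUniformlyOn c c₀ (𝓝[>] 0) K
  remainder_tendsto : ∀ K ⊆ T, IsCompact K → TendstoUniformlyOn R R₀ (𝓝[>] 0) K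
  prefactor_meas : ∀ᶠ θ in 𝓝[>] (0 : ℝ), AEStronglyMeasurable (c θ) (volume.restrict T)
  remainder_meas : ∀ᶠ θ in 𝓝[>] (0 : ℝ), AEStronglyMeasurable (R θ) (volume.restrict T)
  flux : ∀ᶠ θ in 𝓝[>] (0 : ℝ), ∀ g : E → ℝ, ContDiff ℝ 1 g → HasCompactSupport g →
    tsupport g ⊆ T →
    ∫ x in T, fderiv ℝ g x (Real.exp (-V x / θ) • (c θ x • X x + θ • R θ x)) = 0

/-- Testing the flux against `exp(V/θ) ψ` removes the exponential and gives an expansion in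
powers of `θ`. -/
lemma IsDivergenceFreeFlux.expansion {V : E → ℝ} {X : E → E} {c : ℝ → E → ℝ} {c₀ : E → ℝ}
    {R : ℝ → E → E} {R₀ : E → E} (h : IsDivergenceFreeFlux T V X c c₀ R R₀)
    {ψ : E → ℝ} (hψ : ContDiff ℝ ∞ ψ) (hc : HasCompactSupport ψ) (hψT : tsupport ψ ⊆ T) :
    ∃ i₁ i₂ i₃ : ℝ → ℝ,
      Tendsto i₁ (𝓝[>] 0) (𝓝 (∫ x in T, ψ x * (c₀ x * fderiv ℝ V x (X x)))) ∧
      Tendsto i₂ (𝓝[>] 0)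
        (𝓝 (∫ x in T, (ψ x * fderiv ℝ V x (R₀ x) + c₀ x * fderiv ℝ ψ x (X x)))) ∧
      (∃ l, Tendsto i₃ (𝓝[>] 0) (𝓝 l)) ∧
      ((∀ x ∈ T, fderiv ℝ V x (X x) = 0) → ∀ θ, i₁ θ = 0) ∧
      ∀ᶠ θ in 𝓝[>] (0 : ℝ), i₁ θ + θ * i₂ θ + θ ^ 2 * i₃ θ = 0 := by
  have hT := h.isOpen
  have hVc : ContinuousOn (fderiv ℝ V) T := h.exponent.continuousOn_fderiv_of_isOpen hT le_rfl
  have hψ1 : ContDiff ℝ 1 ψ := hψ.of_le (by exact_mod_cast le_top)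
  have hψc : ContinuousOn (fderiv ℝ ψ) T := (hψ1.continuous_fderiv (by simp)).continuousOn
  have z1 : ∀ x ∉ tsupport ψ, ψ x = 0 := fun x hx => image_eq_zero_of_notMem_tsupport hx
  have z2 : ∀ x ∉ tsupport ψ, fderiv ℝ ψ x = 0 := fun x hx =>
    fderiv_eq_zero_of_notMem_tsupport hx
  have hXV := hVc.clm_apply h.field
  have hXψ := hψc.clm_apply h.field
  have hψcont := hψ1.continuous.continuousOn (s := T)
  obtain ⟨n1, t1⟩ := tendsto_setIntegral_clm_apply (F := ℝ) hT hc hψT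
    (A := fun x => (ψ x * fderiv ℝ V x (X x)) • ContinuousLinearMap.id ℝ ℝ)
    ((hψcont.mul hXV).smul continuousOn_const) (fun x hx => by simp [z1 x hx]) h.prefactor
    (h.prefactor_tendsto _ hψT hc) h.prefactor_meas
  obtain ⟨n2, t2⟩ := tendsto_setIntegral_clm_apply hT hc hψT
    (A := fun x => ψ x • fderiv ℝ V x)
    (hψcont.smul hVc) (fun x hx => by simp [z1 x hx]) h.remainder
    (h.remainder_tendsto _ hψT hc) h.remainder_meas
  obtain ⟨n3, t3⟩ := tendsto_setIntegral_clm_apply (F := ℝ) hT hc hψT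
    (A := fun x => (fderiv ℝ ψ x (X x)) • ContinuousLinearMap.id ℝ ℝ)
    (hXψ.smul continuousOn_const) (fun x hx => by simp [z2 x hx]) h.prefactor
    (h.prefactor_tendsto _ hψT hc) h.prefactor_meas
  obtain ⟨n4, t4⟩ := tendsto_setIntegral_clm_apply hT hc hψT
    (A := fun x => fderiv ℝ ψ x) hψc (fun x hx => z2 x hx) h.remainder
    (h.remainder_tendsto _ hψT hc) h.remainder_meas
  simp only [smul_apply, ContinuousLinearMap.id_apply, smul_eq_mul] at n1 t1 n2 t2 n3 t3
  refine ⟨fun θ => ∫ x in T, ψ x * fderiv ℝ V x (X x) * c θ x,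
    fun θ => (∫ x in T, ψ x * fderiv ℝ V x (R θ x)) + ∫ x in T, fderiv ℝ ψ x (X x) * c θ x,
    fun θ => ∫ x in T, fderiv ℝ ψ x (R θ x), ?_, ?_, ⟨_, t4⟩, ?_, ?_⟩
  · convert t1 using 4; ring
  · convert t2.add t3 using 2
    rw [← integral_add]
    · simp_rw [mul_comm (c₀ _)]
    · exact integrableOn_of_continuousOn_of_tsupport hc hψT
        (hψcont.mul (hVc.clm_apply h.remainder)) fun x hx => by simp [z1 x hx]
    · exact integrableOn_of_continuousOn_of_tsupport hc hψT
        (hXψ.mul h.prefactor) fun x hx => by simp [z2 x hx]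
  · intro h0 θ
    exact setIntegral_eq_zero_of_forall_eq_zero fun x hx => by rw [h0 x hx]; simp
  · filter_upwards [n1, n2, n3, n4, h.flux, self_mem_nhdsWithin] with θ n1 n2 n3 n4 hf hθ
    have hθ : (0 : ℝ) < θ := hθ
    have he : ContDiffOn ℝ 1 (fun x => Real.exp (V x / θ)) T := (h.exponent.div_const θ).exp
    have key := hf (fun x => Real.exp (V x / θ) * ψ x)
      (contDiff_mul_of_tsupport (n := 1) hT he hψ1 hψT) hc.mul_left
      ((closure_mono (Function.support_mul_subset_right _ _)).trans hψT)
    have e1 : ∀ x ∈ T, fderiv ℝ (fun x => Real.exp (V x / θ) * ψ x) x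
        (Real.exp (-V x / θ) • (c θ x • X x + θ • R θ x)) =
        θ⁻¹ * (ψ x * fderiv ℝ V x (X x) * c θ x) + (ψ x * fderiv ℝ V x (R θ x) +
          fderiv ℝ ψ x (X x) * c θ x) + θ * fderiv ℝ ψ x (R θ x) := by
      intro x hx
      have dV := (h.exponent.differentiableOn (by simp)).differentiableAt (hT.mem_nhds hx)
      have h1 := ((dV.hasFDerivAt.mul_const θ⁻¹).exp).mul
        (hψ1.differentiable (by simp)).differentiableAt.hasFDerivAt
      simp only [← div_eq_mul_inv] at h1
      have hee : Real.exp (V x / θ) * Real.exp (-V x / θ) = 1 := by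
        rw [← Real.exp_add]; simp [neg_div]
      erw [h1.fderiv]
      simp only [add_apply, smul_apply, smul_eq_mul, map_add, map_smul]
      have hθ' : θ * θ⁻¹ = 1 := mul_inv_cancel₀ hθ.ne'
      generalize Real.exp (V x / θ) = a at *
      generalize Real.exp (-V x / θ) = a' at *
      field_simp
      linear_combination (θ * (fderiv ℝ ψ x (X x) * c θ x + θ * fderiv ℝ ψ x (R θ x)) +
        ψ x * (c θ x * fderiv ℝ V x (X x) + θ * fderiv ℝ V x (R θ x))) * hee
    rw [setIntegral_congr_fun hT.measurableSet e1, integral_add, integral_add, integral_add,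
      integral_const_mul, integral_const_mul] at key
    · have hθ' : θ * θ⁻¹ = 1 := mul_inv_cancel₀ hθ.ne'
      linear_combination θ * key - (∫ x in T, ψ x * fderiv ℝ V x (X x) * c θ x) * hθ'
    · exact n2
    · exact n3
    · exact n1.const_mul _
    · exact n2.add n3
    · exact (n1.const_mul _).add (n2.add n3)
    · exact n4.const_mul _

/-- Leading order: the eikonal (Hamilton–Jacobi) equation. -/
lemma IsDivergenceFreeFlux.eikonal {V : E → ℝ} {X : E → E} {c : ℝ → E → ℝ} {c₀ : E → ℝ}
    {R : ℝ → E → E} {R₀ : E → E} (h : IsDivergenceFreeFlux T V X c c₀ R R₀)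
    (hpos : ∀ x ∈ T, 0 < c₀ x) : ∀ x ∈ T, fderiv ℝ V x (X x) = 0 := by
  have hVc : ContinuousOn (fderiv ℝ V) T :=
    h.exponent.continuousOn_fderiv_of_isOpen h.isOpen le_rfl
  have := eqOn_zero_of_setIntegral_mul_eq_zero h.isOpen
    (F := fun x => c₀ x * fderiv ℝ V x (X x)) (h.prefactor.mul (hVc.clm_apply h.field)) ?_
  · exact fun x hx => (mul_eq_zero.1 (this x hx)).resolve_left (hpos x hx).ne'
  intro ψ hψ hc hψT
  obtain ⟨i₁, i₂, i₃, t1, t2, ⟨l, t3⟩, -, hz⟩ := h.expansion hψ hc hψT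
  have t0 : Tendsto (fun θ : ℝ => θ) (𝓝[>] 0) (𝓝 0) := tendsto_nhdsWithin_of_tendsto_nhds tendsto_id
  have := (t1.add (t0.mul t2)).add ((t0.pow 2).mul t3)
  simp only [zero_mul, add_zero, ne_eq, OfNat.ofNat_ne_zero, not_false_eq_true, zero_pow] at this
  exact tendsto_nhds_unique this ((tendsto_congr' hz).2 tendsto_const_nhds)

/-- Next order: the transport equation for the prefactor, in the case `X = ∇ U`. -/
lemma IsDivergenceFreeFlux.transport {V U : E → ℝ} {c : ℝ → E → ℝ} {c₀ : E → ℝ}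
    {R : ℝ → E → E} {R₀ : E → E} (h : IsDivergenceFreeFlux T V (∇ U) c c₀ R R₀)
    (hpos : ∀ x ∈ T, 0 < c₀ x) (hU : ContDiffOn ℝ 2 U T) (hc₀ : ContDiffOn ℝ 1 c₀ T) :
    ∀ x ∈ T, fderiv ℝ V x (R₀ x) -
      (fderiv ℝ c₀ x (∇ U x) + c₀ x * Laplacian.laplacian U x) = 0 := by
  have hT := h.isOpen
  have hVc : ContinuousOn (fderiv ℝ V) T := h.exponent.continuousOn_fderiv_of_isOpen hT le_rfl
  have hcc : ContinuousOn (fderiv ℝ c₀) T := hc₀.continuousOn_fderiv_of_isOpen hT le_rfl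
  have hL : ContinuousOn (Laplacian.laplacian U) T := by
    have : ContinuousOn (fderiv ℝ (fderiv ℝ U)) T :=
      (hU.fderiv_of_isOpen hT (m := 1) (by norm_num)).continuousOn_fderiv_of_isOpen hT le_rfl
    rw [show Laplacian.laplacian U = _ from funext (laplacian_eq_sum_fderiv
      (stdOrthonormalBasis ℝ E) U)]
    exact continuousOn_finsetSum _ fun i _ =>
      (this.clm_apply continuousOn_const).clm_apply continuousOn_const
  have cA := hVc.clm_apply h.remainder
  have cB := (hcc.clm_apply h.field).add (h.prefactor.mul hL)
  refine eqOn_zero_of_setIntegral_mul_eq_zero hT (cA.sub cB) ?_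
  intro ψ hψ hc hψT
  obtain ⟨i₁, i₂, i₃, -, t2, ⟨l, t3⟩, h1, hz⟩ := h.expansion hψ hc hψT
  have h1 := h1 (h.eikonal hpos)
  have t0 : Tendsto (fun θ : ℝ => θ) (𝓝[>] 0) (𝓝 0) := tendsto_nhdsWithin_of_tendsto_nhds tendsto_id
  have t := t2.add (t0.mul t3)
  have hz' : (fun θ => i₂ θ + θ * i₃ θ) =ᶠ[𝓝[>] 0] fun _ => 0 := by
    filter_upwards [hz, self_mem_nhdsWithin] with θ hθ hθ0
    have hθ0 : (0 : ℝ) < θ := hθ0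
    rw [h1 θ] at hθ
    refine (mul_eq_zero_iff_left hθ0.ne').1 ?_
    rw [← hθ]; ring
  have hψ1 : ContDiff ℝ 1 ψ := hψ.of_le (by exact_mod_cast le_top)
  have hψc : ContinuousOn (fderiv ℝ ψ) T := (hψ1.continuous_fderiv (by simp)).continuousOn
  have e := tendsto_nhds_unique t ((tendsto_congr' hz').2 tendsto_const_nhds)
  have ia : IntegrableOn (fun x => ψ x * fderiv ℝ V x (R₀ x)) T :=
    integrableOn_of_continuousOn_of_tsupport hc hψT (hψ1.continuous.continuousOn.mul cA)
      fun x hx => by simp [image_eq_zero_of_notMem_tsupport hx]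
  have ib : IntegrableOn (fun x => ψ x *
      (fderiv ℝ c₀ x (∇ U x) + c₀ x * Laplacian.laplacian U x)) T :=
    integrableOn_of_continuousOn_of_tsupport hc hψT (hψ1.continuous.continuousOn.mul cB)
      fun x hx => by simp [image_eq_zero_of_notMem_tsupport hx]
  have ic : IntegrableOn (fun x => c₀ x * fderiv ℝ ψ x (∇ U x)) T :=
    integrableOn_of_continuousOn_of_tsupport hc hψT (h.prefactor.mul (hψc.clm_apply h.field))
      fun x hx => by simp [fderiv_eq_zero_of_notMem_tsupport hx]
  rw [integral_add ia ic,
    setIntegral_mul_fderiv_gradient hT hc₀ hU hψ1 hc hψT, zero_mul, add_zero,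
    ← sub_eq_add_neg, ← integral_sub ia ib] at e
  rw [← e]
  exact integral_congr_ae (ae_of_all _ fun x => by simp only; ring)

end

/-! ### Geometry of the tube around a submanifold -/

section

variable {E : Type*} [NormedAddCommGroup E] {M : Set E} {ε : ℝ}

lemma mem_thickening_of_mem (hε : 0 < ε) {p : E} (hp : p ∈ M) : p ∈ Metric.thickening ε M :=
  Metric.self_subset_thickening hε M hp

lemma exists_nearest [ProperSpace E] (hM : IsCompact M) (hne : M.Nonempty) (x : E) :
    ∃ p ∈ M, (∀ q ∈ M, dist x p ≤ dist x q) ∧ Metric.infDist x M = dist x p := by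
  obtain ⟨p, hp, h⟩ := hM.exists_infDist_eq_dist hne x
  exact ⟨p, hp, fun q hq => h ▸ Metric.infDist_le_dist_of_mem hq, h⟩

lemma dist_lt_of_mem_thickening {x p : E} (hx : x ∈ Metric.thickening ε M)
    (hmin : ∀ q ∈ M, dist x p ≤ dist x q) : ‖x - p‖ < ε := by
  obtain ⟨q, hq, h⟩ := Metric.mem_thickening_iff.1 hx
  rw [← dist_eq_norm]
  exact (hmin q hq).trans_lt h

lemma mem_cthickening_iff_infDist_le (hne : M.Nonempty) {r : ℝ} (hr : 0 ≤ r) {x : E} :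
    x ∈ Metric.cthickening r M ↔ Metric.infDist x M ≤ r := by
  rw [Metric.mem_cthickening_iff, Metric.infDist,
    ENNReal.le_ofReal_iff_toReal_le (Metric.infEDist_ne_top hne) hr]

end

section

variable {E : Type*} [NormedAddCommGroup E] [InnerProductSpace ℝ E] {M : Set E} {ε : ℝ}

/-- The vector from a nearest point of `M` is normal to `M`. -/
lemma sub_mem_normalSpaceAt {x p : E} (hmin : ∀ q ∈ M, dist x p ≤ dist x q) :
    x - p ∈ normalSpaceAt M p := by
  rw [normalSpaceAt, Submodule.mem_orthogonal]
  suffices h : tangentSpaceAt M p ≤ (ℝ ∙ (x - p))ᗮ from fun u hu => by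
    have := Submodule.mem_orthogonal_singleton_iff_inner_right.1 (h hu)
    rwa [real_inner_comm] at this
  refine Submodule.span_le.2 ?_
  rintro w ⟨γ, h0, hγM, hγ⟩
  refine Submodule.mem_orthogonal_singleton_iff_inner_right.2 ?_
  have hd : HasDerivAt (fun t => ‖x - γ t‖ ^ 2) (2 * inner ℝ (x - γ 0) (-w)) 0 :=
    (hγ.const_sub x).norm_sq
  have hm : IsLocalMin (fun t => ‖x - γ t‖ ^ 2) 0 := by
    filter_upwards [hγM] with t ht
    have := hmin _ ht
    rw [dist_eq_norm, dist_eq_norm] at this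
    rw [h0]
    gcongr
  have := hm.hasDerivAt_eq_zero hd
  rw [h0, inner_neg_right] at this
  linarith

lemma add_smul_mem_thickening {p v : E} (hp : p ∈ M) (hv : ‖v‖ < ε) {t : ℝ}
    (ht : t ∈ Set.Icc (0 : ℝ) 1) : p + t • v ∈ Metric.thickening ε M := by
  refine Metric.mem_thickening_iff.2 ⟨p, hp, ?_⟩
  rw [dist_eq_norm, add_sub_cancel_left, norm_smul, Real.norm_of_nonneg ht.1]
  exact (mul_le_of_le_one_left (norm_nonneg v) ht.2).trans_lt hv

lemma hasDerivAt_add_smul (p v : E) (t : ℝ) : HasDerivAt (fun t : ℝ => p + t • v) v t := by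
  simpa using ((hasDerivAt_id t).smul_const v).const_add p

/-- Normal convexity makes `f` radially increasing along the normal segments. -/
lemma le_fderiv_of_normal {f : E → ℝ} (hf : ContDiffOn ℝ 2 f (Metric.thickening ε M)) {lam : ℝ}
    (hconv : ∀ p ∈ M, ∀ v ∈ normalSpaceAt M p, ‖v‖ < ε →
      ∀ w ∈ normalSpaceAt M p, lam * ‖w‖ ^ 2 ≤ fderiv ℝ (fderiv ℝ f) (p + v) w w)
    {p v : E} (hp : p ∈ M) (h0 : fderiv ℝ f p = 0) (hv : v ∈ normalSpaceAt M p) (hvε : ‖v‖ < ε) :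
    lam * ‖v‖ ^ 2 ≤ fderiv ℝ f (p + v) v := by
  have hT : IsOpen (Metric.thickening ε M) := Metric.isOpen_thickening
  have hd : ∀ t ∈ Set.Icc (0 : ℝ) 1, HasDerivAt (fun t : ℝ => fderiv ℝ f (p + t • v) v)
      (fderiv ℝ (fderiv ℝ f) (p + t • v) v v) t := by
    intro t ht
    have d1 : DifferentiableAt ℝ (fderiv ℝ f) (p + t • v) :=
      ((hf.fderiv_of_isOpen hT (m := 1) (by norm_num)).differentiableOn (by simp)).differentiableAt
        (hT.mem_nhds (add_smul_mem_thickening hp hvε ht))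
    have := d1.hasFDerivAt.comp_hasDerivAt t (hasDerivAt_add_smul p v t)
    simpa using this.clm_apply (hasDerivAt_const t v)
  obtain ⟨t, ht, he⟩ := exists_hasDerivAt_eq_slope _ _ zero_lt_one
    (fun t ht => (hd t ht).continuousAt.continuousWithinAt)
    (fun t ht => hd t (Set.Ioo_subset_Icc_self ht))
  simp only [one_smul, zero_smul, add_zero, h0, zero_apply, sub_zero, div_one] at he
  rw [← he]
  refine hconv p hp (t • v) (Submodule.smul_mem _ _ hv) ?_ v hv
  rw [norm_smul, Real.norm_of_nonneg ht.1.le]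
  exact (mul_le_of_le_one_left (norm_nonneg v) ht.2.le).trans_lt hvε

/-- Normal convexity gives quadratic growth along the normal segments. -/
lemma le_sub_of_normal {f : E → ℝ} (hf : ContDiffOn ℝ 2 f (Metric.thickening ε M)) {lam : ℝ}
    (hconv : ∀ p ∈ M, ∀ v ∈ normalSpaceAt M p, ‖v‖ < ε →
      ∀ w ∈ normalSpaceAt M p, lam * ‖w‖ ^ 2 ≤ fderiv ℝ (fderiv ℝ f) (p + v) w w)
    {p v : E} (hp : p ∈ M) (h0 : fderiv ℝ f p = 0) (hv : v ∈ normalSpaceAt M p) (hvε : ‖v‖ < ε) :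
    lam / 2 * ‖v‖ ^ 2 ≤ f (p + v) - f p := by
  have hT : IsOpen (Metric.thickening ε M) := Metric.isOpen_thickening
  have hd : ∀ t ∈ Set.Icc (0 : ℝ) 1, HasDerivAt
      (fun t : ℝ => f (p + t • v) - lam / 2 * ‖v‖ ^ 2 * t ^ 2)
      (fderiv ℝ f (p + t • v) v - lam / 2 * ‖v‖ ^ 2 * (2 * t)) t := by
    intro t ht
    have d1 : DifferentiableAt ℝ f (p + t • v) := (hf.differentiableOn (by simp)).differentiableAt
        (hT.mem_nhds (add_smul_mem_thickening hp hvε ht))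
    have := d1.hasFDerivAt.comp_hasDerivAt t (hasDerivAt_add_smul p v t)
    refine this.sub (HasDerivAt.const_mul _ ?_)
    simpa using hasDerivAt_pow 2 t
  obtain ⟨t, ht, he⟩ := exists_hasDerivAt_eq_slope _ _ zero_lt_one
    (fun t ht => (hd t ht).continuousAt.continuousWithinAt)
    (fun t ht => hd t (Set.Ioo_subset_Icc_self ht))
  have h1 := le_fderiv_of_normal hf hconv hp h0 (Submodule.smul_mem _ t hv) (by
    rw [norm_smul, Real.norm_of_nonneg ht.1.le]
    exact (mul_le_of_le_one_left (norm_nonneg v) ht.2.le).trans_lt hvε)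
  rw [map_smul, smul_eq_mul, norm_smul, Real.norm_of_nonneg ht.1.le] at h1
  have h2 : lam * t * ‖v‖ ^ 2 ≤ fderiv ℝ f (p + t • v) v := by
    refine le_of_mul_le_mul_left ?_ ht.1
    nlinarith
  simp only [one_smul, zero_smul, add_zero] at he
  norm_num at he
  nlinarith

lemma eventually_lt_of_hasDerivAt_pos {f : ℝ → ℝ} {f' : ℝ} (h : HasDerivAt f f' 0) (hf' : 0 < f') :
    ∀ᶠ t in 𝓝[>] (0 : ℝ), f 0 < f t := by
  have h1 := (hasDerivAt_iff_tendsto_slope_zero.1 h).mono_left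
    (nhdsWithin_mono 0 (fun t (ht : 0 < t) => ht.ne'))
  filter_upwards [h1.eventually (lt_mem_nhds hf'), self_mem_nhdsWithin] with t ht ht0
  have ht0 : 0 < t := ht0
  rw [zero_add, smul_eq_mul] at ht
  have := pos_of_mul_pos_right ht (inv_pos.2 ht0).le
  linarith

/-- A function whose differential vanishes on a connected submanifold is constant on it. -/
lemma exists_eq_const_of_fderiv_eq_zero {k : WithTop ℕ∞} (hk : 1 ≤ k) {n : ℕ}
    (hM : IsEmbeddedSubmanifold k n M) (hconn : IsConnected M) {F : E → ℝ}
    (hF : ∀ x ∈ M, DifferentiableAt ℝ F x) (hF0 : ∀ x ∈ M, fderiv ℝ F x = 0) :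
    ∃ a, ∀ x ∈ M, F x = a := by
  have hloc : ∀ p ∈ M, ∃ W ∈ 𝓝 p, ∀ q ∈ W ∩ M, F q = F p := by
    intro p hp
    obtain ⟨φ, S, hps, -, -, hsymm, hS⟩ := hM p hp
    obtain ⟨r, hr, hball⟩ := Metric.isOpen_iff.1 φ.open_target (φ p) (φ.map_source hps)
    refine ⟨φ.source ∩ φ ⁻¹' Metric.ball (φ p) r, ?_, ?_⟩
    · exact (φ.isOpen_inter_preimage Metric.isOpen_ball).mem_nhds
        ⟨hps, Metric.mem_ball_self hr⟩
    · rintro q ⟨⟨hqs, hqb⟩, hqM⟩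
      set γ : ℝ → E := fun t => φ p + t • (φ q - φ p) with hγ
      have hγb : ∀ t ∈ Set.Icc (0 : ℝ) 1, γ t ∈ Metric.ball (φ p) r := by
        intro t ht
        have := (convex_ball (φ p) r).add_smul_sub_mem (Metric.mem_ball_self hr) hqb ht
        exact this
      have hγM : ∀ t ∈ Set.Icc (0 : ℝ) 1, φ.symm (γ t) ∈ M := by
        intro t ht
        have ht' := hball (hγb t ht)
        rw [hS _ (φ.map_target ht'), φ.right_inv ht']
        exact S.add_mem ((hS p hps).1 hp)
          (S.smul_mem t (S.sub_mem ((hS q hqs).1 hqM) ((hS p hps).1 hp)))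
      have hder : ∀ t ∈ Set.Icc (0 : ℝ) 1, HasDerivAt (fun t => F (φ.symm (γ t))) 0 t := by
        intro t ht
        have d1 : DifferentiableAt ℝ φ.symm (γ t) :=
          (hsymm.differentiableOn (by positivity)).differentiableAt
            (φ.open_target.mem_nhds (hball (hγb t ht)))
        have d2 := d1.hasFDerivAt.comp_hasDerivAt t (hasDerivAt_add_smul (φ p) (φ q - φ p) t)
        have d3 := (hF _ (hγM t ht)).hasFDerivAt.comp_hasDerivAt t d2
        rw [hF0 _ (hγM t ht)] at d3
        exact d3
      have := constant_of_has_deriv_right_zero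
        (fun t ht => (hder t ht).continuousAt.continuousWithinAt)
        (fun t ht => (hder t (Set.Ico_subset_Icc_self ht)).hasDerivWithinAt) 1 (by simp)
      simpa [hγ, φ.left_inv hqs, φ.left_inv hps] using this
  obtain ⟨p₀, hp₀⟩ := hconn.nonempty
  have : PreconnectedSpace M := Subtype.preconnectedSpace hconn.isPreconnected
  have hlc : IsLocallyConstant fun x : M => F x := by
    rw [IsLocallyConstant.iff_eventually_eq]
    rintro ⟨p, hp⟩
    obtain ⟨W, hW, h⟩ := hloc p hp
    filter_upwards [continuous_subtype_val.continuousAt.preimage_mem_nhds hW] with y hy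
    exact h y ⟨hy, y.2⟩
  exact ⟨F p₀, fun x hx => hlc.apply_eq_of_preconnectedSpace ⟨x, hx⟩ ⟨p₀, hp₀⟩⟩

/-! ### Functions invariant under the gradient flow -/

variable [FiniteDimensional ℝ E]

/-- A maximum principle: if `∇ V` points away from `M` on a closed tube and `u` is constant along
the gradient lines of `V`, then `u` does not exceed its value on `M`. At a positive maximum of
`(u - a) exp(-V)`, following `-∇ V` stays in the tube and increases this function. -/
lemma le_of_fderiv_gradient_eq_zero (hM : IsCompact M) (hne : M.Nonempty) {r a : ℝ}
    (hr0 : 0 ≤ r) {V u : E → ℝ}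
    (hV : ∀ x ∈ Metric.cthickening r M, DifferentiableAt ℝ V x)
    (hu : ∀ x ∈ Metric.cthickening r M, DifferentiableAt ℝ u x)
    (hVu : ∀ x ∈ Metric.cthickening r M, fderiv ℝ u x (∇ V x) = 0)
    (hout : ∀ x ∈ Metric.cthickening r M, x ∉ M → ∀ p ∈ M, (∀ q ∈ M, dist x p ≤ dist x q) →
      0 < fderiv ℝ V x (x - p))
    (ha : ∀ x ∈ M, u x = a) : ∀ x ∈ Metric.cthickening r M, u x ≤ a := by
  intro y hy
  set K := Metric.cthickening r M
  set q : E → ℝ := fun x => (u x - a) * Real.exp (-V x) with hq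
  have hqd : ∀ x ∈ K, DifferentiableAt ℝ q x := fun x hx =>
    ((hu x hx).sub_const a).mul (hV x hx).neg.exp
  obtain ⟨x, hxK, hmax⟩ := hM.cthickening.exists_isMaxOn ⟨y, hy⟩
    (fun x hx => (hqd x hx).continuousAt.continuousWithinAt)
  by_contra hcon
  have hqy : 0 < q y := mul_pos (by linarith) (Real.exp_pos _)
  have hqx : 0 < q x := hqy.trans_le (hmax hy)
  have hxM : x ∉ M := fun h => by simp [hq, ha x h] at hqx
  obtain ⟨p, hpM, hnear, hpd⟩ := exists_nearest hM hne x
  have hpos := hout x hxK hxM p hpM hnear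
  have hgrad : ∇ V x ≠ 0 := fun h => by
    rw [← inner_gradient_eq_fderiv, h, inner_zero_right] at hpos
    exact lt_irrefl _ hpos
  have hγ := hasDerivAt_add_smul x (-∇ V x) 0
  have dq : HasDerivAt (fun t : ℝ => q (x + t • (-∇ V x))) (q x * ‖∇ V x‖ ^ 2) 0 := by
    have h1 := ((hu x hxK).hasFDerivAt.sub_const a).mul (hV x hxK).hasFDerivAt.neg.exp
    have h2 := h1.comp_hasDerivAt_of_eq (0 : ℝ) hγ (by simp)
    refine h2.congr_deriv ?_
    have h3 : fderiv ℝ V x (∇ V x) = ‖∇ V x‖ ^ 2 := by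
      rw [← inner_gradient_eq_fderiv, real_inner_self_eq_norm_sq]
    simp only [add_apply, smul_apply, neg_apply, map_neg, hVu x hxK, h3, hq, smul_eq_mul,
      Pi.neg_apply]
    ring
  have dd : HasDerivAt (fun t : ℝ => -‖x + t • (-∇ V x) - p‖ ^ 2)
      (2 * fderiv ℝ V x (x - p)) 0 := by
    refine (hγ.sub_const p).norm_sq.neg.congr_deriv ?_
    rw [zero_smul, add_zero, inner_neg_right, inner_gradient_eq_fderiv]
    ring
  have e1 := eventually_lt_of_hasDerivAt_pos dq (by positivity)
  have e2 := eventually_lt_of_hasDerivAt_pos dd (by positivity)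
  obtain ⟨t, h1, h2⟩ := (e1.and e2).exists
  simp only [zero_smul, add_zero, neg_lt_neg_iff] at h1 h2
  refine h1.not_ge (hmax ?_)
  rw [mem_cthickening_iff_infDist_le hne hr0] at hxK ⊢
  refine (Metric.infDist_le_dist_of_mem hpM).trans (le_trans ?_ (hpd ▸ hxK))
  rw [dist_eq_norm, dist_eq_norm]
  exact (lt_of_pow_lt_pow_left₀ 2 (norm_nonneg _) h2).le

lemma eq_of_fderiv_gradient_eq_zero (hM : IsCompact M) (hne : M.Nonempty) {r a : ℝ}
    (hr0 : 0 ≤ r) {V u : E → ℝ}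
    (hV : ∀ x ∈ Metric.cthickening r M, DifferentiableAt ℝ V x)
    (hu : ∀ x ∈ Metric.cthickening r M, DifferentiableAt ℝ u x)
    (hVu : ∀ x ∈ Metric.cthickening r M, fderiv ℝ u x (∇ V x) = 0)
    (hout : ∀ x ∈ Metric.cthickening r M, x ∉ M → ∀ p ∈ M, (∀ q ∈ M, dist x p ≤ dist x q) →
      0 < fderiv ℝ V x (x - p))
    (ha : ∀ x ∈ M, u x = a) : ∀ x ∈ Metric.cthickening r M, u x = a := by
  intro x hx
  refine le_antisymm (le_of_fderiv_gradient_eq_zero hM hne hr0 hV hu hVu hout ha x hx) ?_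
  have := le_of_fderiv_gradient_eq_zero (u := fun x => -u x) (a := -a) hM hne hr0 hV
    (fun x hx => (hu x hx).neg) (fun x hx => by rw [fderiv_fun_neg]; simp [hVu x hx]) hout
    (fun x hx => by rw [ha x hx]) x hx
  linarith

/-- If a gradient vanishes to first order on `M`, it is small compared with the distance to `M`. -/
lemma exists_norm_fderiv_le (hM : IsCompact M) (hne : M.Nonempty) (hε : 0 < ε) {U : E → ℝ}
    (hU : ContDiffOn ℝ 2 U (Metric.thickening ε M)) (hU1 : ∀ p ∈ M, fderiv ℝ U p = 0)
    (hU2 : ∀ p ∈ M, fderiv ℝ (fderiv ℝ U) p = 0) {η : ℝ} (hη : 0 < η) :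
    ∃ δ, 0 < δ ∧ δ < ε ∧ ∀ x ∈ Metric.cthickening δ M, ∀ p ∈ M, (∀ q ∈ M, dist x p ≤ dist x q) →
      ‖fderiv ℝ U x‖ ≤ η * ‖x - p‖ := by
  have hT : IsOpen (Metric.thickening ε M) := Metric.isOpen_thickening
  have hU' := hU.fderiv_of_isOpen hT (m := 1) (by norm_num)
  have hc : ContinuousOn (fun x => ‖fderiv ℝ (fderiv ℝ U) x‖) (Metric.thickening ε M) :=
    (hU'.continuousOn_fderiv_of_isOpen hT le_rfl).norm
  have ho : IsOpen (Metric.thickening ε M ∩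
      (fun x => ‖fderiv ℝ (fderiv ℝ U) x‖) ⁻¹' Set.Iio η) := hc.isOpen_inter_preimage hT isOpen_Iio
  obtain ⟨δ, hδ, hδs⟩ := hM.exists_cthickening_subset_open ho (fun p hp =>
    ⟨mem_thickening_of_mem hε hp, by
      have : ‖fderiv ℝ (fderiv ℝ U) p‖ = 0 := by
        rw [hU2 p hp]; exact ContinuousLinearMap.opNorm_zero
      simpa only [Set.mem_preimage, this, Set.mem_Iio] using hη⟩)
  refine ⟨min δ (ε / 2), by positivity, (min_le_right _ _).trans_lt (by linarith), ?_⟩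
  intro x hx p hp hmin
  have hx' : x ∈ Metric.cthickening δ M := Metric.cthickening_mono (min_le_left _ _) M hx
  have hxp : dist x p ≤ δ := by
    obtain ⟨p', hp', -, h⟩ := exists_nearest hM hne x
    rw [mem_cthickening_iff_infDist_le hne hδ.le, h] at hx'
    exact (hmin p' hp').trans hx'
  have hseg : ∀ y ∈ segment ℝ p x, y ∈ Metric.cthickening δ M := by
    intro y hy
    refine Metric.mem_cthickening_of_dist_le y p δ M hp ?_
    have : y ∈ Metric.closedBall p δ :=
      (convex_closedBall p δ).segment_subset (Metric.mem_closedBall_self hδ.le) hxp hy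
    exact this
  have := (convex_segment p x).norm_image_sub_le_of_norm_fderiv_le (𝕜 := ℝ) (f := fderiv ℝ U)
    (C := η) (fun y hy => (hU'.differentiableOn (by simp)).differentiableAt
      (hT.mem_nhds (hδs (hseg y hy)).1)) (fun y hy => (hδs (hseg y hy)).2.le)
    (left_mem_segment ℝ p x) (right_mem_segment ℝ p x)
  rwa [hU1 p hp, sub_zero] at this

/-- Propagation of the exponent from `M` to the whole tube: a solution `V = f + U` of the eikonal
equation `⟨∇ V, ∇ U⟩ = 0` which agrees with `f + a` to second order on `M` is equal to `f + a`.
On a maximal tube where `U = a`, the gradient of `V` is that of `f`, which points outwards; this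
persists slightly further out, where the maximum principle applies. -/
lemma eq_const_of_eikonal (hM : IsCompact M) (hne : M.Nonempty) (hε : 0 < ε) {f V : E → ℝ}
    (hf : ContDiffOn ℝ 2 f (Metric.thickening ε M))
    (hV : ContDiffOn ℝ 2 V (Metric.thickening ε M)) {lam : ℝ} (hlam : 0 < lam)
    (hrad : ∀ x ∈ Metric.thickening ε M, ∀ p ∈ M, (∀ q ∈ M, dist x p ≤ dist x q) →
      lam * ‖x - p‖ ^ 2 ≤ fderiv ℝ f x (x - p))
    (hHJ : ∀ x ∈ Metric.thickening ε M, fderiv ℝ (fun y => V y - f y) x (∇ V x) = 0)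
    (hU1 : ∀ p ∈ M, fderiv ℝ (fun y => V y - f y) p = 0)
    (hU2 : ∀ p ∈ M, fderiv ℝ (fderiv ℝ fun y => V y - f y) p = 0) {a : ℝ}
    (ha : ∀ p ∈ M, V p - f p = a) : ∀ x ∈ Metric.thickening ε M, V x - f x = a := by
  set T := Metric.thickening ε M with hTdef
  have hT : IsOpen T := Metric.isOpen_thickening
  set U : E → ℝ := fun y => V y - f y with hUdef
  have hU : ContDiffOn ℝ 2 U T := hV.sub hf
  have dV : ∀ x ∈ T, DifferentiableAt ℝ V x := fun x hx =>
    (hV.differentiableOn (by simp)).differentiableAt (hT.mem_nhds hx)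
  have df : ∀ x ∈ T, DifferentiableAt ℝ f x := fun x hx =>
    (hf.differentiableOn (by simp)).differentiableAt (hT.mem_nhds hx)
  have dU : ∀ x ∈ T, DifferentiableAt ℝ U x := fun x hx => (dV x hx).sub (df x hx)
  have hsum : ∀ x ∈ T, ∀ w, fderiv ℝ V x w = fderiv ℝ f x w + fderiv ℝ U x w := fun x hx w => by
    rw [hUdef, fderiv_fun_sub (dV x hx) (df x hx)]; simp
  obtain ⟨δ, hδ, hδε, hsmall⟩ := exists_norm_fderiv_le hM hne hε hU hU1 hU2 (half_pos hlam)
  have hKT : ∀ r < ε, Metric.cthickening r M ⊆ T := fun r hr =>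
    Metric.cthickening_subset_thickening' hε hr M
  have hpos : ∀ x ∉ M, ∀ p ∈ M, 0 < ‖x - p‖ := fun x hx p hp =>
    norm_pos_iff.2 (sub_ne_zero.2 fun h => hx (h ▸ hp))
  have hnear : ∀ x ∈ Metric.cthickening δ M, x ∉ M → ∀ p ∈ M, (∀ q ∈ M, dist x p ≤ dist x q) →
      0 < fderiv ℝ V x (x - p) := by
    intro x hx hxM p hp hmin
    have h1 := hsmall x hx p hp hmin
    have h2 := hrad x (hKT δ hδε hx) p hp hmin
    have h3 := (abs_le.1 ((fderiv ℝ U x).le_opNorm (x - p))).1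
    have h4 := hpos x hxM p hp
    rw [hsum x (hKT δ hδε hx)]
    nlinarith [mul_le_mul_of_nonneg_right h1 h4.le, mul_pos hlam (pow_pos h4 2)]
  have hext : ∀ r, 0 ≤ r → r < ε → (∀ x ∈ Metric.cthickening r M, x ∉ M → ∀ p ∈ M,
      (∀ q ∈ M, dist x p ≤ dist x q) → 0 < fderiv ℝ V x (x - p)) →
      ∀ x ∈ Metric.cthickening r M, U x = a := fun r hr0 hr h =>
    eq_of_fderiv_gradient_eq_zero hM hne hr0 (fun x hx => dV x (hKT r hr hx))
      (fun x hx => dU x (hKT r hr hx)) (fun x hx => hHJ x (hKT r hr hx)) h ha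
  -- the radii of the closed tubes on which `U = a`
  set S : Set ℝ := {r | (0 ≤ r ∧ r < ε) ∧ ∀ x ∈ Metric.cthickening r M, U x = a} with hS
  have hδS : δ ∈ S := ⟨⟨hδ.le, hδε⟩, hext δ hδ.le hδε hnear⟩
  have hbdd : BddAbove S := ⟨ε, fun r hr => hr.1.2.le⟩
  set r := sSup S with hr
  have hδr : δ ≤ r := le_csSup hbdd hδS
  have hUr : ∀ x ∈ Metric.thickening r M, U x = a := by
    intro x hx
    rw [Metric.mem_thickening_iff_infDist_lt hne] at hx
    obtain ⟨s, hs, hxs⟩ := exists_lt_of_lt_csSup ⟨δ, hδS⟩ hx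
    exact hs.2 x ((mem_cthickening_iff_infDist_le hne hs.1.1).2 hxs.le)
  rcases (csSup_le ⟨δ, hδS⟩ fun s hs => hs.1.2.le : r ≤ ε).eq_or_lt with heq | hlt
  · have heq : r = ε := heq
    rwa [heq] at hUr
  exfalso
  have hcont : ContinuousOn (fun x => ‖fderiv ℝ U x‖) T :=
    (hU.continuousOn_fderiv_of_isOpen hT (by norm_num)).norm
  have hzero : ∀ x ∈ Metric.cthickening r M, ‖fderiv ℝ U x‖ = 0 := by
    intro x hx
    have hx' := hx
    rw [← closure_thickening (hδ.trans_le hδr)] at hx'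
    have h1 : Set.EqOn (fun x => ‖fderiv ℝ U x‖) (fun _ => 0) (Metric.thickening r M) := by
      intro y hy
      have : U =ᶠ[𝓝 y] fun _ => a :=
        Filter.eventually_of_mem (Metric.isOpen_thickening.mem_nhds hy) hUr
      simp [this.fderiv_eq]
    exact h1.of_subset_closure (hcont.mono (hKT r hlt)) continuousOn_const
      (Metric.thickening_subset_cthickening r M)
      (closure_thickening (hδ.trans_le hδr) M).symm.subset hx
  have ho : IsOpen (T ∩ (fun x => ‖fderiv ℝ U x‖) ⁻¹' Set.Iio (lam * δ)) :=
    hcont.isOpen_inter_preimage hT isOpen_Iio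
  obtain ⟨s, hs, hss⟩ := hM.cthickening.exists_cthickening_subset_open ho (fun x hx =>
    ⟨hKT r hlt hx, by simp only [Set.mem_preimage, hzero x hx]; exact mul_pos hlam hδ⟩)
  rw [cthickening_cthickening hs.le (hδ.le.trans hδr)] at hss
  set r' := min (s + r) ((r + ε) / 2) with hr'
  have h1 : r < r' := lt_min (by linarith) (by linarith)
  have h0 : 0 ≤ r' := (hδ.le.trans hδr).trans h1.le
  have h2 : r' < ε := (min_le_right _ _).trans_lt (by linarith)
  refine (le_csSup hbdd (⟨⟨h0, h2⟩, hext r' h0 h2 ?_⟩ : r' ∈ S)).not_gt h1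
  intro x hx hxM p hp hmin
  -- near `M` the second order estimate applies, further out `‖∇ U‖ < lam δ` does
  by_cases hxp : dist x p ≤ δ
  · exact hnear x (Metric.mem_cthickening_of_dist_le x p δ M hp hxp) hxM p hp hmin
  · have hb := (hss (Metric.cthickening_mono (min_le_left _ _) M hx)).2
    simp only [Set.mem_preimage, Set.mem_Iio] at hb
    have h2 := hrad x (hKT r' h2 hx) p hp hmin
    have h3 := (abs_le.1 ((fderiv ℝ U x).le_opNorm (x - p))).1
    have h4 := hpos x hxM p hp
    rw [dist_eq_norm, not_le] at hxp
    rw [hsum x (hKT r' (by assumption) hx)]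
    nlinarith [mul_lt_mul_of_pos_right hb h4, mul_lt_mul_of_pos_left hxp (mul_pos hlam h4)]

end

/-! ### The Hessian on the submanifold -/

section

variable {E : Type*} [NormedAddCommGroup E] [InnerProductSpace ℝ E]

lemma map_eq_zero_of_inner_self_eq_zero {A : E →ₗ[ℝ] E} (hA : A.IsSymmetric)
    (hpos : ∀ w, 0 ≤ inner ℝ (A w) w) {v : E} (hv : inner ℝ (A v) v = 0) : A v = 0 := by
  have key : ∀ t : ℝ, 0 ≤ inner ℝ (A (A v)) (A v) * (t * t) + 2 * ‖A v‖ ^ 2 * t + 0 := by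
    intro t
    have h := hpos (v + t • A v)
    have h1 : inner ℝ (A (A v)) v = ‖A v‖ ^ 2 := by rw [hA, real_inner_self_eq_norm_sq]
    simp only [map_add, map_smul, inner_add_left, inner_add_right, real_inner_smul_left,
      real_inner_smul_right, hv, h1, real_inner_self_eq_norm_sq (A v)] at h
    linarith
  have h := discrim_le_zero key
  simp only [discrim, mul_zero, sub_zero] at h
  have h2 : 2 * ‖A v‖ ^ 2 = 0 := pow_eq_zero_iff (two_ne_zero) |>.1 (le_antisymm h (sq_nonneg _))
  exact norm_eq_zero.1 (pow_eq_zero_iff two_ne_zero |>.1 (by linarith))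

/-- The only solution of the Riccati equation `H² = (H A + A H) / 2` with `A ≥ 0` and the trace
of `A` is `H = A`. In an eigenbasis of `H`, every diagonal entry of `H - A` is nonpositive, so all
of them vanish; hence `H ≥ 0`, and off-diagonal entries are killed by sums of eigenvalues. -/
lemma eq_of_inner_sub_eq_zero_of_trace [FiniteDimensional ℝ E] {H A : E →ₗ[ℝ] E}
    (hH : H.IsSymmetric) (hA : A.IsSymmetric) (hpos : ∀ w, 0 ≤ inner ℝ (A w) w)
    (hq : ∀ w, inner ℝ (H w) (H w - A w) = 0)
    (htr : ∀ e : OrthonormalBasis (Fin (Module.finrank ℝ E)) ℝ E,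
      ∑ i, inner ℝ (H (e i) - A (e i)) (e i) = 0) : H = A := by
  set e := hH.eigenvectorBasis rfl
  set μ := hH.eigenvalues rfl
  have hμ : ∀ i, H (e i) = μ i • e i := fun i => hH.apply_eigenvectorBasis rfl i
  have hdiag : ∀ i, inner ℝ (H (e i)) (e i) = μ i := fun i => by
    rw [hμ, real_inner_smul_left, real_inner_self_eq_norm_sq, e.norm_eq_one]; simp
  have hprod : ∀ i, μ i * inner ℝ (H (e i) - A (e i)) (e i) = 0 := fun i => by
    have := hq (e i)
    rw [hμ i, real_inner_smul_left, ← hμ i, real_inner_comm] at this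
    exact this
  have hle : ∀ i, inner ℝ (H (e i) - A (e i)) (e i) ≤ 0 := fun i => by
    rcases mul_eq_zero.1 (hprod i) with h | h
    · rw [inner_sub_left, hdiag, h]
      linarith [hpos (e i)]
    · exact h.le
  have hzero : ∀ i, inner ℝ (H (e i) - A (e i)) (e i) = 0 := fun i =>
    (Finset.sum_eq_zero_iff_of_nonpos fun i _ => hle i).1 (htr e) i (Finset.mem_univ i)
  have hAd : ∀ i, inner ℝ (A (e i)) (e i) = μ i := fun i => by
    have := hzero i
    rw [inner_sub_left, hdiag] at this
    linarith
  have hμ0 : ∀ i, 0 ≤ μ i := fun i => hAd i ▸ hpos (e i)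
  have hker : ∀ i, μ i = 0 → H (e i) - A (e i) = 0 := fun i hi => by
    rw [hμ i, hi, map_eq_zero_of_inner_self_eq_zero hA hpos ((hAd i).trans hi)]; simp
  have hpol : ∀ i j, (μ i + μ j) * inner ℝ (e i) (H (e j) - A (e j)) = 0 := fun i j => by
    have h1 := hq (e i + e j)
    have hs : inner ℝ (e j) (H (e i) - A (e i)) = inner ℝ (e i) (H (e j) - A (e j)) := by
      rw [inner_sub_right, inner_sub_right, ← hH, ← hA, real_inner_comm, real_inner_comm (e i)]
    have h2 : H (e i + e j) - A (e i + e j) = (H (e i) - A (e i)) + (H (e j) - A (e j)) := by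
      simp only [map_add]; abel
    rw [h2, map_add, inner_add_left, inner_add_right, inner_add_right, hq, hq, hμ i, hμ j,
      real_inner_smul_left, real_inner_smul_left, ← hμ i, ← hμ j, hs] at h1
    linarith
  refine e.toBasis.ext fun j => ?_
  rw [OrthonormalBasis.coe_toBasis, ← sub_eq_zero]
  by_cases hj : μ j = 0
  · exact hker j hj
  · have hj' : 0 < μ j := lt_of_le_of_ne (hμ0 j) (Ne.symm hj)
    rw [← e.sum_repr' (H (e j) - A (e j))]
    refine Finset.sum_eq_zero fun i _ => ?_
    rw [(mul_eq_zero.1 (hpol i j)).resolve_left (by linarith [hμ0 i]), zero_smul]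

variable {T : Set E}

lemma fderiv_fderiv_nonneg_of_isLocalMin {f : E → ℝ} {p : E} (hf : ContDiffAt ℝ 2 f p)
    (hmin : IsLocalMin f p) (w : E) : 0 ≤ fderiv ℝ (fderiv ℝ f) p w w := by
  by_contra hneg
  have hγ := hasDerivAt_add_smul p w
  have hγt : Tendsto (fun t : ℝ => p + t • w) (𝓝[>] 0) (𝓝 p) := by
    have := (hγ 0).continuousAt.tendsto
    rw [zero_smul, add_zero] at this
    exact this.mono_left nhdsWithin_le_nhds
  have d2 : DifferentiableAt ℝ (fderiv ℝ f) p :=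
    (hf.fderiv_right (m := 1) (by norm_num)).differentiableAt (by simp)
  have h2 : HasDerivAt (fun t : ℝ => -fderiv ℝ f (p + t • w) w)
      (-fderiv ℝ (fderiv ℝ f) p w w) 0 := by
    have := d2.hasFDerivAt.comp_hasDerivAt_of_eq (0 : ℝ) (hγ 0) (by simp)
    refine (this.clm_apply (hasDerivAt_const 0 w)).neg.congr_deriv ?_
    simp
  have h3 := eventually_lt_of_hasDerivAt_pos h2 (by linarith)
  simp only [zero_smul, add_zero, hmin.fderiv_eq_zero, zero_apply, neg_zero] at h3
  have h4 : ∀ᶠ t in 𝓝[>] (0 : ℝ), DifferentiableAt ℝ f (p + t • w) :=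
    hγt.eventually ((hf.eventually (by simp)).mono fun x hx => hx.differentiableAt (by simp))
  have h5 : ∀ᶠ t in 𝓝[>] (0 : ℝ), f p ≤ f (p + t • w) := hγt.eventually hmin
  obtain ⟨s, hs0, hs⟩ := mem_nhdsGT_iff_exists_Ioo_subset.1 (h3.and (h4.and h5))
  have hs0 : 0 < s := hs0
  have hd : ∀ t ∈ Set.Ioo 0 s, HasDerivAt (fun t : ℝ => f (p + t • w))
      (fderiv ℝ f (p + t • w) w) t := fun t ht =>
    (hs ht).2.1.hasFDerivAt.comp_hasDerivAt t (hγ t)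
  have hd0 : ContinuousAt (fun t : ℝ => f (p + t • w)) 0 := by
    refine ContinuousAt.comp (x := (0 : ℝ)) (g := f) ?_ (hγ 0).continuousAt
    simpa using hf.continuousAt
  obtain ⟨t, ht, he⟩ := exists_hasDerivAt_eq_slope (fun t : ℝ => f (p + t • w)) _ (half_pos hs0)
    (fun t ht => by
      rcases ht.1.eq_or_lt with h | h
      · exact h ▸ hd0.continuousWithinAt
      · exact (hd t ⟨h, by linarith [ht.2]⟩).continuousAt.continuousWithinAt)
    (fun t ht => hd t ⟨ht.1, by linarith [ht.2]⟩)
  have h6 := (hs (show t ∈ Set.Ioo 0 s from ⟨ht.1, by linarith [ht.2]⟩)).1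
  have h7 := (hs (show s / 2 ∈ Set.Ioo 0 s from ⟨by linarith, by linarith⟩)).2.2
  simp only [zero_smul, add_zero, sub_zero] at he
  have : 0 ≤ fderiv ℝ f (p + t • w) w := he ▸ div_nonneg (sub_nonneg.2 h7) (by linarith)
  linarith

variable [FiniteDimensional ℝ E]

lemma tendsto_smul_gradient {g : E → ℝ} {p : E} (hg : ContDiffAt ℝ 2 g p) (h0 : fderiv ℝ g p = 0)
    (w : E) : Tendsto (fun t : ℝ => t⁻¹ • ∇ g (p + t • w)) (𝓝[≠] 0)
      (𝓝 ((InnerProductSpace.toDual ℝ E).symm (fderiv ℝ (fderiv ℝ g) p w))) := by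
  have d2 : DifferentiableAt ℝ (fderiv ℝ g) p :=
    (hg.fderiv_right (m := 1) (by norm_num)).differentiableAt (by simp)
  have h := hasDerivAt_iff_tendsto_slope_zero.1
    (d2.hasFDerivAt.comp_hasDerivAt_of_eq (0 : ℝ) (hasDerivAt_add_smul p w 0) (by simp))
  have h' := ((InnerProductSpace.toDual ℝ E).symm.continuous.tendsto _).comp h
  refine h'.congr fun t => ?_
  simp [h0, gradient]

/-- At a minimum point `p` of `f`, a solution `V` of the eikonal equation `⟨∇ V, ∇ (V - f)⟩ = 0`
such that `Δ (V - f)` vanishes at `p` agrees with `f` to second order, up to a constant. -/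
lemma fderiv_eq_zero_of_eikonal {f V : E → ℝ} (hT : IsOpen T) (hf : ContDiffOn ℝ 2 f T)
    (hV : ContDiffOn ℝ 2 V T)
    (hHJ : ∀ x ∈ T, fderiv ℝ V x (∇ (fun y => V y - f y) x) = 0) {p : E} (hp : p ∈ T)
    (hmin : IsLocalMin f p) :
    fderiv ℝ V p = 0 ∧ fderiv ℝ (fun y => V y - f y) p = 0 ∧
    (Laplacian.laplacian (fun y => V y - f y) p = 0 →
      fderiv ℝ (fderiv ℝ fun y => V y - f y) p = 0) := by
  have cf : ContDiffAt ℝ 2 f p := hf.contDiffAt (hT.mem_nhds hp)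
  have cV : ContDiffAt ℝ 2 V p := hV.contDiffAt (hT.mem_nhds hp)
  set U : E → ℝ := fun y => V y - f y with hU
  have cU : ContDiffAt ℝ 2 U p := cV.sub cf
  have f0 : fderiv ℝ f p = 0 := hmin.fderiv_eq_zero
  have hUV : fderiv ℝ U p = fderiv ℝ V p := by
    rw [hU, fderiv_fun_sub (cV.differentiableAt (by simp)) (cf.differentiableAt (by simp)), f0,
      sub_zero]
  have hgV : ∇ V p = 0 := by
    have h := hHJ p hp
    rw [gradient, hUV, ← gradient, ← inner_gradient_eq_fderiv] at h
    exact inner_self_eq_zero.1 h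
  have hV0 : fderiv ℝ V p = 0 := by
    rw [gradient] at hgV
    exact (LinearIsometryEquiv.map_eq_zero_iff _).1 hgV
  have hU0 : fderiv ℝ U p = 0 := hUV.trans hV0
  refine ⟨hV0, hU0, fun hL => ?_⟩
  have eU2 : fderiv ℝ (fderiv ℝ U) p = fderiv ℝ (fderiv ℝ V) p - fderiv ℝ (fderiv ℝ f) p := by
    have he : fderiv ℝ U =ᶠ[𝓝 p] fun x => fderiv ℝ V x - fderiv ℝ f x := by
      filter_upwards [hT.mem_nhds hp] with x hx
      exact fderiv_fun_sub ((hV.differentiableOn (by simp)).differentiableAt (hT.mem_nhds hx))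
        ((hf.differentiableOn (by simp)).differentiableAt (hT.mem_nhds hx))
    rw [he.fderiv_eq]
    exact fderiv_fun_sub ((cV.fderiv_right (m := 1) (by norm_num)).differentiableAt (by simp))
      ((cf.fderiv_right (m := 1) (by norm_num)).differentiableAt (by simp))
  let Op : (E → ℝ) → E →ₗ[ℝ] E := fun g =>
    { toFun := fun v => (InnerProductSpace.toDual ℝ E).symm (fderiv ℝ (fderiv ℝ g) p v)
      map_add' := fun v w => by rw [map_add, map_add]
      map_smul' := fun t v => by rw [map_smul]; exact map_smulₛₗ _ _ _ }
  have hOp : ∀ g v w, inner ℝ (Op g v) w = fderiv ℝ (fderiv ℝ g) p v w := fun g v w => by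
    change inner ℝ ((InnerProductSpace.toDual ℝ E).symm _) w = _
    rw [InnerProductSpace.toDual_symm_apply]
  have hsym : ∀ g, ContDiffAt ℝ 2 g p → (Op g).IsSymmetric := fun g hg v w => by
    rw [hOp, real_inner_comm, hOp]
    exact (hg.isSymmSndFDerivAt (by simp)) v w
  have hsub : ∀ w, Op U w = Op V w - Op f w := fun w => by
    refine ext_inner_right ℝ fun z => ?_
    rw [inner_sub_left, hOp, hOp, hOp, eU2]; simp
  have hmain : Op V = Op f := by
    refine eq_of_inner_sub_eq_zero_of_trace (hsym V cV) (hsym f cf) (fun w => ?_) (fun w => ?_)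
      (fun e => ?_)
    · rw [hOp]; exact fderiv_fderiv_nonneg_of_isLocalMin cf hmin w
    · rw [← hsub]
      have h1 := (tendsto_smul_gradient cV hV0 w).inner (𝕜 := ℝ) (tendsto_smul_gradient cU hU0 w)
      have hγ : Tendsto (fun t : ℝ => p + t • w) (𝓝[≠] 0) (𝓝 p) := by
        have := (hasDerivAt_add_smul p w 0).continuousAt.tendsto
        rw [zero_smul, add_zero] at this
        exact this.mono_left nhdsWithin_le_nhds
      have h2 : (fun t : ℝ => inner ℝ (t⁻¹ • ∇ V (p + t • w)) (t⁻¹ • ∇ U (p + t • w)))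
          =ᶠ[𝓝[≠] 0] fun _ => 0 := by
        filter_upwards [hγ.eventually (hT.mem_nhds hp)] with t ht
        rw [real_inner_smul_left, real_inner_smul_right, real_inner_comm, inner_gradient_eq_fderiv,
          hHJ _ ht]
        simp
      exact tendsto_nhds_unique h1 ((tendsto_congr' h2).2 tendsto_const_nhds)
    · rw [← hL, laplacian_eq_sum_fderiv e]
      exact Finset.sum_congr rfl fun i _ => by rw [← hsub, hOp]
  ext v w
  rw [← hOp, hsub, hmain]
  simp

end

/-! ### Laplace-type volume bounds near a submanifold -/

/-- A `C¹` chart distorts volumes near a point by factors bounded above and below. -/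
lemma exists_det_bounds {E : Type*} [NormedAddCommGroup E] [NormedSpace ℝ E]
    {φ : OpenPartialHomeomorph E E} (hφ : ContDiffOn ℝ 1 φ φ.source)
    (hφs : ContDiffOn ℝ 1 φ.symm φ.target) {y₀ : E} (hy : y₀ ∈ φ.target) :
    ∃ r > 0, Metric.closedBall y₀ r ⊆ φ.target ∧ ∃ c > 0, ∃ C > 0,
      ∀ y ∈ Metric.closedBall y₀ r,
        c ≤ |(fderiv ℝ φ.symm y).det| ∧ |(fderiv ℝ φ.symm y).det| ≤ C := by
  have hcont : ContinuousOn (fun y => |(fderiv ℝ φ.symm y).det|) φ.target :=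
    (ContinuousLinearMap.continuous_det.comp_continuousOn
      (hφs.continuousOn_fderiv_of_isOpen φ.open_target le_rfl)).abs
  have hne : (fderiv ℝ φ.symm y₀).det ≠ 0 := by
    have d1 := ((hφs.differentiableOn (by simp)).differentiableAt
      (φ.open_target.mem_nhds hy)).hasFDerivAt
    have d2 := ((hφ.differentiableOn (by simp)).differentiableAt
      (φ.open_source.mem_nhds (φ.map_target hy))).hasFDerivAt
    have h := d2.comp y₀ d1
    have he : (φ ∘ φ.symm) =ᶠ[𝓝 y₀] id := by
      filter_upwards [φ.open_target.mem_nhds hy] with y hy using φ.right_inv hy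
    have h2 := (h.congr_of_eventuallyEq he.symm).unique (hasFDerivAt_id y₀)
    intro h0
    have h3 := congrArg (fun L : E →L[ℝ] E => LinearMap.det (L : E →ₗ[ℝ] E)) h2
    have h4 : LinearMap.det ((fderiv ℝ φ (φ.symm y₀)).comp (fderiv ℝ φ.symm y₀) : E →ₗ[ℝ] E) =
        LinearMap.det (fderiv ℝ φ (φ.symm y₀) : E →ₗ[ℝ] E) * (fderiv ℝ φ.symm y₀).det :=
      LinearMap.det_comp _ _
    have h5 : LinearMap.det (ContinuousLinearMap.id ℝ E : E →ₗ[ℝ] E) = 1 := LinearMap.det_id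
    rw [h0, mul_zero] at h4
    exact zero_ne_one (h4.symm.trans (h3.trans h5))
  set D := |(fderiv ℝ φ.symm y₀).det|
  have hD : 0 < D := abs_pos.2 hne
  have hev : ∀ᶠ y in 𝓝 y₀, y ∈ φ.target ∧
      |(fderiv ℝ φ.symm y).det| ∈ Set.Ioo (D / 2) (2 * D) :=
    (φ.open_target.eventually_mem hy).and
      ((hcont.continuousAt (φ.open_target.mem_nhds hy)).eventually
        (Ioo_mem_nhds (by simp only [D] at hD ⊢; linarith) (by simp only [D] at hD ⊢; linarith)))
  obtain ⟨r, hr, h⟩ := Metric.nhds_basis_closedBall.eventually_iff.1 hev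
  exact ⟨r, hr, fun y hy => (h hy).1, D / 2, by positivity, 2 * D, by positivity,
    fun y hy => ⟨(h hy).2.1.le, (h hy).2.2.le⟩⟩

section

variable {E : Type*} [NormedAddCommGroup E] [InnerProductSpace ℝ E] [FiniteDimensional ℝ E]

/-- The linear map which is the identity on `S` and the dilation by `s` on `Sᗮ`. -/
def normalDilation (S : Submodule ℝ E) (s : ℝ) : E →L[ℝ] E :=
  S.starProjection + s • Sᗮ.starProjection

lemma det_normalDilation (S : Submodule ℝ E) (s : ℝ) :
    LinearMap.det (normalDilation S s : E →ₗ[ℝ] E) =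
      s ^ (Module.finrank ℝ E - Module.finrank ℝ S) := by
  have hS : ∀ x ∈ S, normalDilation S s x = x := fun x hx => by
    have h1 : S.starProjection x = x := Submodule.starProjection_eq_self_iff.2 hx
    simp [normalDilation, Submodule.starProjection_orthogonal_val, h1]
  have hle : S ≤ S.comap (normalDilation S s : E →ₗ[ℝ] E) := fun x hx => by
    rw [Submodule.mem_comap, ContinuousLinearMap.coe_coe, hS x hx]; exact hx
  rw [LinearMap.det_eq_det_mul_det S _ hle]
  have h1 : (normalDilation S s : E →ₗ[ℝ] E).restrict hle = LinearMap.id := by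
    ext x
    exact hS x x.2
  have h2 : S.mapQ S (normalDilation S s : E →ₗ[ℝ] E) hle = s • LinearMap.id := by
    refine LinearMap.ext fun y => ?_
    obtain ⟨x, rfl⟩ := Submodule.Quotient.mk_surjective S y
    rw [Submodule.mapQ_apply, LinearMap.smul_apply, LinearMap.id_apply,
      ← Submodule.Quotient.mk_smul, Submodule.Quotient.eq]
    have : (normalDilation S s : E →ₗ[ℝ] E) x - s • x =
        S.starProjection x - s • S.starProjection x := by
      simp only [normalDilation, ContinuousLinearMap.coe_coe, add_apply, smul_apply,
        Submodule.starProjection_orthogonal_val]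
      module
    rw [this]
    exact S.sub_mem (S.starProjection_apply_mem x)
      (S.smul_mem _ (S.starProjection_apply_mem x))
  rw [h1, h2, LinearMap.det_id, LinearMap.det_smul, LinearMap.det_id, Submodule.finrank_quotient]
  ring

lemma starProjection_normalDilation (S : Submodule ℝ E) (s : ℝ) (z : E) :
    S.starProjection (normalDilation S s z) = S.starProjection z := by
  have h1 : S.starProjection (S.starProjection z) = S.starProjection z :=
    Submodule.starProjection_eq_self_iff.2 (S.starProjection_apply_mem z)
  simp [normalDilation, Submodule.starProjection_orthogonal_val, h1]

lemma starProjection_orthogonal_normalDilation (S : Submodule ℝ E) (s : ℝ) (z : E) :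
    Sᗮ.starProjection (normalDilation S s z) = s • Sᗮ.starProjection z := by
  have h1 : S.starProjection (S.starProjection z) = S.starProjection z :=
    Submodule.starProjection_eq_self_iff.2 (S.starProjection_apply_mem z)
  rw [Submodule.starProjection_orthogonal_val, starProjection_normalDilation,
    Submodule.starProjection_orthogonal_val]
  simp only [normalDilation, add_apply, smul_apply, Submodule.starProjection_orthogonal_val]
  module

lemma norm_normalDilation_le (S : Submodule ℝ E) {s : ℝ} (hs : 0 ≤ s) (hs1 : s ≤ 1) (z : E) :
    ‖normalDilation S s z‖ ≤ ‖z‖ := by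
  refine le_of_sq_le_sq ?_ (norm_nonneg _)
  rw [S.norm_sq_eq_add_norm_sq_starProjection (normalDilation S s z),
    S.norm_sq_eq_add_norm_sq_starProjection z, starProjection_normalDilation,
    starProjection_orthogonal_normalDilation, norm_smul, Real.norm_of_nonneg hs]
  have : s * ‖Sᗮ.starProjection z‖ ≤ ‖Sᗮ.starProjection z‖ :=
    mul_le_of_le_one_left (norm_nonneg _) hs1
  gcongr

variable [MeasurableSpace E] [BorelSpace E]

lemma integrable_exp_neg_mul_norm_sq {c : ℝ} (hc : 0 < c) :
    Integrable fun z : E => Real.exp (-(c * ‖z‖ ^ 2)) := by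
  have h := (GaussianFourier.integrable_cexp_neg_mul_sq_norm_add (V := E) (b := (c : ℂ))
    (by simpa using hc) 0 0).norm
  refine h.congr (ae_of_all _ fun z => ?_)
  simp only [Complex.norm_exp]
  congr 1
  norm_cast
  simp

/-- A Gaussian of variance `s²` in the directions normal to `S`, cut off to a ball. -/
lemma exists_lintegral_gaussian_le (S : Submodule ℝ E) {c : ℝ} (hc : 0 < c) (y₀ : E) (R : ℝ) :
    ∃ C : ℝ, 0 ≤ C ∧ ∀ s : ℝ, 0 < s →
      ∫⁻ y in Metric.closedBall y₀ R, ENNReal.ofReal (Real.exp (-(c * ‖Sᗮ.starProjection y‖ ^ 2 /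
        s ^ 2))) ≤ ENNReal.ofReal (C * s ^ (Module.finrank ℝ E - Module.finrank ℝ S)) := by
  set R' := ‖y₀‖ + R
  set I := ∫ z : E, Real.exp (-(c * ‖z‖ ^ 2))
  have hI : 0 ≤ I := integral_nonneg fun z => (Real.exp_pos _).le
  refine ⟨Real.exp (c * R' ^ 2) * I, by positivity, fun s hs => ?_⟩
  set G : E → ENNReal := fun y => ENNReal.ofReal (Real.exp (c * R' ^ 2) *
    Real.exp (-(c * (‖S.starProjection y‖ ^ 2 + ‖Sᗮ.starProjection y‖ ^ 2 / s ^ 2)))) with hG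
  have hGm : Measurable G := by
    refine ENNReal.measurable_ofReal.comp (Continuous.measurable ?_)
    fun_prop
  have hdet : LinearMap.det (normalDilation S s : E →ₗ[ℝ] E) ≠ 0 := by
    rw [det_normalDilation]; positivity
  have hGD : ∀ z, G (normalDilation S s z) =
      ENNReal.ofReal (Real.exp (c * R' ^ 2) * Real.exp (-(c * ‖z‖ ^ 2))) := fun z => by
    simp only [hG, starProjection_normalDilation, starProjection_orthogonal_normalDilation,
      norm_smul, Real.norm_of_nonneg hs.le]
    rw [S.norm_sq_eq_add_norm_sq_starProjection z, mul_pow, mul_div_cancel_left₀ _ (by positivity)]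
  have h1 : ∫⁻ y, G y = ENNReal.ofReal (s ^ (Module.finrank ℝ E - Module.finrank ℝ S)) *
      ∫⁻ z, G (normalDilation S s z) := by
    have := Measure.map_linearMap_addHaar_eq_smul_addHaar (volume : Measure E) hdet
    have h2 : ∫⁻ z, G (normalDilation S s z) =
        ∫⁻ y, G y ∂(Measure.map (normalDilation S s : E →ₗ[ℝ] E) volume) :=
      (lintegral_map hGm (normalDilation S s).continuous.measurable).symm
    rw [h2, this, lintegral_smul_measure, smul_eq_mul, ← mul_assoc, det_normalDilation,
      ← ENNReal.ofReal_mul (by positivity), abs_of_nonneg (by positivity),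
      mul_inv_cancel₀ (by positivity), ENNReal.ofReal_one, one_mul]
  calc _ ≤ ∫⁻ y in Metric.closedBall y₀ R, G y := by
        refine setLIntegral_mono hGm fun y hy => ENNReal.ofReal_le_ofReal ?_
        rw [← Real.exp_add]
        refine Real.exp_le_exp.2 ?_
        have h2 : ‖S.starProjection y‖ ≤ R' := by
          refine (S.norm_starProjection_apply_le y).trans ?_
          have := norm_add_le y₀ (y - y₀)
          rw [add_sub_cancel, ← dist_eq_norm] at this
          linarith [Metric.mem_closedBall.1 hy]
        have h3 : c * ‖S.starProjection y‖ ^ 2 ≤ c * R' ^ 2 := by gcongr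
        rw [mul_add, mul_div_assoc]
        linarith
    _ ≤ ∫⁻ y, G y := setLIntegral_le_lintegral _ _
    _ = _ := by
        rw [h1]
        simp_rw [hGD]
        rw [← ofReal_integral_eq_lintegral_ofReal
          ((integrable_exp_neg_mul_norm_sq hc).const_mul _)
          (ae_of_all _ fun z => by positivity), integral_const_mul,
          ← ENNReal.ofReal_mul (by positivity), mul_comm]

variable {M : Set E} {n : ℕ}

/-- Laplace upper bound: if `g` grows at least like the squared distance to `M`, the integral of
`exp(-g / s²)` over a compact set is at most of the order of `s` to the codimension of `M`. -/
lemma exists_lintegral_exp_neg_le {k : WithTop ℕ∞} (hk : 1 ≤ k)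
    (hM : IsEmbeddedSubmanifold k n M) (hMc : IsCompact M) (hne : M.Nonempty) {T K : Set E}
    (hK : IsCompact K) (hT : IsOpen T) (hKT : K ⊆ T) {g : E → ℝ} {c : ℝ} (hc : 0 < c)
    (hg : ∀ x ∈ T, c * Metric.infDist x M ^ 2 ≤ g x) :
    ∃ C : ℝ, 0 ≤ C ∧ ∀ s ∈ Set.Ioc (0 : ℝ) 1,
      ∫⁻ x in K, ENNReal.ofReal (Real.exp (-(g x / s ^ 2))) ≤
        ENNReal.ofReal (C * s ^ (Module.finrank ℝ E - n)) := by
  set m := Module.finrank ℝ E - n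
  refine hK.induction_on (p := fun K : Set E => ∃ C : ℝ, 0 ≤ C ∧ ∀ s ∈ Set.Ioc (0 : ℝ) 1,
    ∫⁻ x in K, ENNReal.ofReal (Real.exp (-(g x / s ^ 2))) ≤ ENNReal.ofReal (C * s ^ m))
    ?_ ?_ ?_ ?_
  · exact ⟨0, le_rfl, by simp⟩
  · rintro A B hAB ⟨C, hC, h⟩
    exact ⟨C, hC, fun s hs => (lintegral_mono_set hAB).trans (h s hs)⟩
  · rintro A B ⟨C, hC, h⟩ ⟨C', hC', h'⟩
    refine ⟨C + C', by positivity, fun s hs => (lintegral_union_le _ A B).trans ?_⟩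
    have h0 : 0 ≤ s ^ m := pow_nonneg hs.1.le m
    rw [add_mul, ENNReal.ofReal_add (by positivity) (by positivity)]
    exact add_le_add (h s hs) (h' s hs)
  intro x₀ hx₀
  by_cases hxM : x₀ ∈ M
  · obtain ⟨φ, S, hps, hSn, hφ, hφs, hS⟩ := hM x₀ hxM
    obtain ⟨r, hr, hrt, c₁, hc₁, C₁, hC₁, hdet⟩ := exists_det_bounds (hφ.of_le hk) (hφs.of_le hk)
      (φ.map_source hps)
    obtain ⟨L, W, hW, hL⟩ := ((hφ.of_le hk).contDiffAt
      (φ.open_source.mem_nhds hps)).exists_lipschitzOnWith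
    obtain ⟨ρ, hρ, hρW⟩ := Metric.mem_nhds_iff.1 (inter_mem hW (φ.open_source.mem_nhds hps))
    set A := Metric.closedBall (φ x₀) r
    obtain ⟨C, hC, hCs⟩ := exists_lintegral_gaussian_le S
      (show 0 < c / (L + 1) ^ 2 by positivity) (φ x₀) r
    rw [hSn] at hCs
    set N := (T ∩ Metric.ball x₀ (ρ / 2)) ∩ (φ.source ∩ φ ⁻¹' Metric.ball (φ x₀) r) with hN
    have hNx : N ∈ 𝓝 x₀ := inter_mem
      (inter_mem (hT.mem_nhds (hKT hx₀)) (Metric.ball_mem_nhds _ (by positivity)))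
      ((φ.isOpen_inter_preimage Metric.isOpen_ball).mem_nhds ⟨hps, Metric.mem_ball_self hr⟩)
    -- in the chart, the distance to `M` controls the normal coordinate
    have hkey : ∀ x ∈ N, c / (L + 1) ^ 2 * ‖Sᗮ.starProjection (φ x)‖ ^ 2 ≤ g x := by
      rintro x ⟨⟨hxT, hxb⟩, hxs, -⟩
      obtain ⟨q, hq, hmin, hd⟩ := exists_nearest hMc hne x
      refine le_trans ?_ (hg x hxT)
      have hxb' : dist x x₀ < ρ / 2 := hxb
      have hqb : q ∈ Metric.ball x₀ ρ := by
        have := dist_triangle_left q x₀ x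
        have h2 := hmin x₀ hxM
        rw [Metric.mem_ball]
        linarith
      have hxb2 : x ∈ Metric.ball x₀ ρ := by rw [Metric.mem_ball]; linarith
      have h1 : dist (φ x) (φ q) ≤ L * dist x q :=
        hL.dist_le_mul x (hρW hxb2).1 q (hρW hqb).1
      have hqS : φ q ∈ S := (hS q (hρW hqb).2).1 hq
      have h2 : ‖Sᗮ.starProjection (φ x)‖ ≤ dist (φ x) (φ q) := by
        have h3 : Sᗮ.starProjection (φ x) = Sᗮ.starProjection (φ x - φ q) := by
          rw [map_sub, Submodule.starProjection_orthogonal_val (φ q),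
            Submodule.starProjection_eq_self_iff.2 hqS]; simp
        rw [h3, dist_eq_norm]
        exact Sᗮ.norm_starProjection_apply_le _
      rw [hd, div_mul_eq_mul_div, div_le_iff₀ (by positivity), mul_assoc, ← mul_pow]
      have h4 : ‖Sᗮ.starProjection (φ x)‖ ≤ dist x q * (L + 1) := by
        nlinarith [dist_nonneg (x := x) (y := q)]
      gcongr
    have hNsub : N ⊆ φ.symm '' A := fun x hx =>
      ⟨φ x, Metric.ball_subset_closedBall hx.2.2, φ.left_inv hx.2.1⟩
    have hNm : NullMeasurableSet N := by
      refine (IsOpen.measurableSet ?_).nullMeasurableSet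
      exact (hT.inter Metric.isOpen_ball).inter (φ.isOpen_inter_preimage Metric.isOpen_ball)
    refine ⟨N, mem_nhdsWithin_of_mem_nhds hNx, C₁ * C, by positivity, fun s hs => ?_⟩
    have hs0 : 0 < s := hs.1
    calc ∫⁻ x in N, ENNReal.ofReal (Real.exp (-(g x / s ^ 2)))
        ≤ ∫⁻ x in N, ENNReal.ofReal
            (Real.exp (-(c / (L + 1) ^ 2 * ‖Sᗮ.starProjection (φ x)‖ ^ 2 / s ^ 2))) := by
          refine lintegral_mono_ae ?_
          filter_upwards [ae_restrict_mem₀ hNm] with x hx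
          have := hkey x hx
          gcongr
      _ ≤ ∫⁻ x in φ.symm '' A, ENNReal.ofReal
            (Real.exp (-(c / (L + 1) ^ 2 * ‖Sᗮ.starProjection (φ x)‖ ^ 2 / s ^ 2))) :=
          lintegral_mono_set hNsub
      _ = ∫⁻ y in A, ENNReal.ofReal |(fderiv ℝ φ.symm y).det| * ENNReal.ofReal
            (Real.exp (-(c / (L + 1) ^ 2 * ‖Sᗮ.starProjection (φ (φ.symm y))‖ ^ 2 / s ^ 2))) :=
          lintegral_image_eq_lintegral_abs_det_fderiv_mul volume
            Metric.isClosed_closedBall.measurableSet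
            (fun y hy => (((hφs.of_le hk).differentiableOn (by simp)).differentiableAt
              (φ.open_target.mem_nhds (hrt hy))).hasFDerivAt.hasFDerivWithinAt)
            (φ.symm.injOn.mono hrt) _
      _ ≤ ∫⁻ y in A, ENNReal.ofReal C₁ * ENNReal.ofReal
            (Real.exp (-(c / (L + 1) ^ 2 * ‖Sᗮ.starProjection y‖ ^ 2 / s ^ 2))) := by
          refine lintegral_mono_ae ?_
          filter_upwards [ae_restrict_mem Metric.isClosed_closedBall.measurableSet] with y hy
          rw [φ.right_inv (hrt hy)]
          gcongr
          exact (hdet y hy).2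
      _ ≤ _ := by
          rw [lintegral_const_mul' _ _ ENNReal.ofReal_ne_top, mul_assoc,
            ENNReal.ofReal_mul hC₁.le]
          gcongr
          exact hCs s hs0
  -- away from `M` the integrand is exponentially small, hence below any power of `s`
  · have hd0 : 0 < Metric.infDist x₀ M := (hMc.isClosed.notMem_iff_infDist_pos hne).1 hxM
    set δ := Metric.infDist x₀ M / 2 with hδ
    have hδ0 : 0 < δ := by positivity
    set N := T ∩ Metric.ball x₀ δ
    have hNo : IsOpen N := hT.inter Metric.isOpen_ball
    have hvol : volume N ≠ ⊤ := (measure_mono_top (Set.inter_subset_right)).mt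
      (measure_ball_lt_top (μ := (volume : Measure E))).ne
    set C := (m.factorial : ℝ) / (c * δ ^ 2) ^ m
    refine ⟨N, mem_nhdsWithin_of_mem_nhds (hNo.mem_nhds ⟨hKT hx₀, Metric.mem_ball_self hδ0⟩),
      C * (volume N).toReal, by positivity, fun s hs => ?_⟩
    have hs0 : 0 < s := hs.1
    have hkey : ∀ x ∈ N, Real.exp (-(g x / s ^ 2)) ≤ C * s ^ m := by
      rintro x ⟨hxT, hxb⟩
      have h1 : δ ≤ Metric.infDist x M := by
        have := Metric.infDist_le_infDist_add_dist (s := M) (x := x₀) (y := x)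
        have h2 : dist x x₀ < δ := hxb
        rw [dist_comm] at h2
        linarith
      have h2 : c * δ ^ 2 ≤ g x := le_trans (by gcongr) (hg x hxT)
      have h3 := Real.pow_div_factorial_le_exp (c * δ ^ 2 / s ^ 2) (by positivity) m
      have h4 : Real.exp (-(g x / s ^ 2)) ≤ Real.exp (-(c * δ ^ 2 / s ^ 2)) := by gcongr
      refine h4.trans ?_
      rw [Real.exp_neg]
      have h5 : (Real.exp (c * δ ^ 2 / s ^ 2))⁻¹ ≤ C * (s ^ 2) ^ m := by
        refine (inv_anti₀ (by positivity) h3).trans_eq ?_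
        simp only [C, div_pow]
        field_simp
      refine h5.trans ?_
      have h6 : (s ^ 2) ^ m ≤ s ^ m := by
        have : s ^ 2 ≤ s := by nlinarith [hs.2]
        gcongr
      gcongr
    calc ∫⁻ x in N, ENNReal.ofReal (Real.exp (-(g x / s ^ 2)))
        ≤ ∫⁻ _ in N, ENNReal.ofReal (C * s ^ m) := by
          refine lintegral_mono_ae ?_
          filter_upwards [ae_restrict_mem hNo.measurableSet] with x hx
          exact ENNReal.ofReal_le_ofReal (hkey x hx)
      _ = _ := by
          rw [setLIntegral_const, mul_right_comm,
            ENNReal.ofReal_mul (p := C * s ^ m) (by positivity), ENNReal.ofReal_toReal hvol]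

/-- Laplace lower bound: if `g` vanishes to first order on `M`, the integral of `exp(-g / s²)` over
a ball centred on `M` is at least of the order of `s` to the codimension of `M`. -/
lemma exists_le_lintegral_exp_neg {k : WithTop ℕ∞} (hk : 1 ≤ k)
    (hM : IsEmbeddedSubmanifold k n M) {g : E → ℝ} {p : E} (hp : p ∈ M) (hg : ContDiffAt ℝ 2 g p)
    (hg0 : ∀ q ∈ M, g q = 0) (hg1 : ∀ q ∈ M, fderiv ℝ g q = 0) {r₀ : ℝ} (hr₀ : 0 < r₀) :
    ∃ c > 0, ∀ s ∈ Set.Ioc (0 : ℝ) 1, ENNReal.ofReal (c * s ^ (Module.finrank ℝ E - n)) ≤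
      ∫⁻ x in Metric.ball p r₀, ENNReal.ofReal (Real.exp (-(g x / s ^ 2))) := by
  obtain ⟨φ, S, hps, hSn, hφ, hφs, hS⟩ := hM p hp
  obtain ⟨r, hr, hrt, c₁, hc₁, C₁, hC₁, hdet⟩ := exists_det_bounds (hφ.of_le hk) (hφs.of_le hk)
    (φ.map_source hps)
  obtain ⟨L, W, hW, hL⟩ := ((hφs.of_le hk).contDiffAt
    (φ.open_target.mem_nhds (φ.map_source hps))).exists_lipschitzOnWith
  obtain ⟨B, N, hN, hB⟩ := ((hg.fderiv_right (m := 1) (by norm_num))).exists_lipschitzOnWith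
  obtain ⟨ρ, hρ, hρN⟩ := Metric.mem_nhds_iff.1 (inter_mem hN (inter_mem (Metric.ball_mem_nhds p hr₀)
    (hg.eventually (by simp))))
  -- on a small ball of the chart, `g` is at most quadratic in the normal coordinate
  have hev : ∀ᶠ y in 𝓝 (φ p), y ∈ W ∧ φ.symm y ∈ Metric.ball p ρ := by
    refine (show ∀ᶠ y in 𝓝 (φ p), y ∈ W from hW).and ?_
    have := (φ.continuousAt_symm (φ.map_source hps)).eventually_mem
      (Metric.isOpen_ball.mem_nhds (by rw [φ.left_inv hps]; exact Metric.mem_ball_self hρ :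
        φ.symm (φ p) ∈ Metric.ball p ρ))
    exact this
  obtain ⟨η', hη', hη'b⟩ := Metric.nhds_basis_closedBall.eventually_iff.1 hev
  set η := min η' r
  have hη : 0 < η := lt_min hη' hr
  have hηW : ∀ y ∈ Metric.closedBall (φ p) η, y ∈ W ∧ φ.symm y ∈ Metric.ball p ρ := fun y hy =>
    hη'b (Metric.closedBall_subset_closedBall (min_le_left _ _) hy)
  have hηr : Metric.closedBall (φ p) η ⊆ Metric.closedBall (φ p) r :=
    Metric.closedBall_subset_closedBall (min_le_right _ _)
  have hpS : φ p ∈ S := (hS p hps).1 hp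
  have hPp : S.starProjection (φ p) = φ p := Submodule.starProjection_eq_self_iff.2 hpS
  have hquad : ∀ y ∈ Metric.closedBall (φ p) η,
      g (φ.symm y) ≤ B * L ^ 2 * ‖Sᗮ.starProjection y‖ ^ 2 := by
    intro y hy
    have hPy : S.starProjection y ∈ Metric.closedBall (φ p) η := by
      rw [Metric.mem_closedBall, dist_eq_norm, ← hPp, ← map_sub]
      rw [Metric.mem_closedBall, dist_eq_norm] at hy
      exact (S.norm_starProjection_apply_le _).trans hy
    set q := φ.symm (S.starProjection y) with hq
    have hqM : q ∈ M := by
      have ht := hrt (hηr hPy)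
      rw [hS q (φ.map_target ht), hq, φ.right_inv ht]
      exact S.starProjection_apply_mem y
    have hd : dist (φ.symm y) q ≤ L * ‖Sᗮ.starProjection y‖ := by
      have := hL.dist_le_mul y (hηW y hy).1 _ (hηW _ hPy).1
      rwa [dist_eq_norm y, ← Submodule.starProjection_orthogonal_val] at this
    have hxq : ‖g (φ.symm y) - g q‖ ≤ (B * dist (φ.symm y) q) * ‖φ.symm y - q‖ := by
      have hseg : segment ℝ q (φ.symm y) ⊆ Metric.ball p ρ :=
        (convex_ball p ρ).segment_subset (hηW _ hPy).2 (hηW y hy).2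
      refine (convex_segment q (φ.symm y)).norm_image_sub_le_of_norm_fderiv_le (𝕜 := ℝ)
        (fun z hz => ?_) (fun z hz => ?_) (left_mem_segment ℝ _ _) (right_mem_segment ℝ _ _)
      · have h : ContDiffAt ℝ 2 g z := (hρN (hseg hz)).2.2
        exact h.differentiableAt (by simp)
      · have h1 := hB.dist_le_mul z (hρN (hseg hz)).1 q (hρN (hηW _ hPy).2).1
        rw [hg1 q hqM, dist_zero_right] at h1
        refine h1.trans ?_
        gcongr
        have : z ∈ Metric.closedBall q (dist (φ.symm y) q) :=
          (convex_closedBall q _).segment_subset (Metric.mem_closedBall_self dist_nonneg)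
            (Metric.mem_closedBall.2 le_rfl) hz
        exact this
    rw [hg0 q hqM, sub_zero, ← dist_eq_norm] at hxq
    refine (le_abs_self _).trans (hxq.trans ?_)
    calc B * dist (φ.symm y) q * dist (φ.symm y) q
        ≤ B * (L * ‖Sᗮ.starProjection y‖) * (L * ‖Sᗮ.starProjection y‖) := by gcongr
      _ = _ := by ring
  set A := Metric.closedBall (φ p) η
  set v := (volume A).toReal
  have hvtop : volume A ≠ ⊤ := (isCompact_closedBall (φ p) η).measure_lt_top.ne
  have hv : 0 < v := ENNReal.toReal_pos (Metric.measure_closedBall_pos volume _ hη).ne' hvtop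
  refine ⟨c₁ * Real.exp (-(B * L ^ 2 * η ^ 2)) * v, by positivity, fun s hs => ?_⟩
  have hs0 : 0 < s := hs.1
  -- restrict to the ellipsoid of size `s` in the normal directions, where `g` is of order `s²`
  set A' := normalDilation S s '' A with hA'
  have hA'A : A' ⊆ A := by
    rintro _ ⟨z, hz, rfl⟩
    have h1 : normalDilation S s (φ p) = φ p := by
      simp [normalDilation, Submodule.starProjection_orthogonal_val, hPp]
    have h2 : dist (normalDilation S s z) (φ p) ≤ dist z (φ p) := by
      conv_lhs => rw [← h1, dist_eq_norm, ← map_sub]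
      rw [dist_eq_norm]
      exact norm_normalDilation_le S hs0.le hs.2 _
    exact h2.trans hz
  have hA'm : MeasurableSet A' :=
    ((isCompact_closedBall (φ p) η).image (normalDilation S s).continuous).measurableSet
  have hval : ∀ y ∈ A', Real.exp (-(B * L ^ 2 * η ^ 2)) ≤
      Real.exp (-(g (φ.symm y) / s ^ 2)) := by
    intro y hy
    have h1 := hquad y (hA'A hy)
    obtain ⟨z, hz, rfl⟩ := hy
    rw [starProjection_orthogonal_normalDilation, norm_smul, Real.norm_of_nonneg hs0.le] at h1
    refine Real.exp_le_exp.2 (neg_le_neg ?_)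
    rw [div_le_iff₀ (by positivity)]
    refine h1.trans ?_
    have h2 : ‖Sᗮ.starProjection z‖ ≤ η := by
      have h3 : Sᗮ.starProjection z = Sᗮ.starProjection (z - φ p) := by
        rw [map_sub, Submodule.starProjection_orthogonal_val (φ p), hPp]; simp
      rw [h3]
      refine (Sᗮ.norm_starProjection_apply_le _).trans ?_
      rw [← dist_eq_norm]; exact hz
    rw [mul_pow, mul_assoc _ (η ^ 2), mul_comm (η ^ 2)]
    gcongr
  calc ENNReal.ofReal (c₁ * Real.exp (-(B * L ^ 2 * η ^ 2)) * v *
        s ^ (Module.finrank ℝ E - n))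
      = ENNReal.ofReal (c₁ * Real.exp (-(B * L ^ 2 * η ^ 2))) * volume A' := by
        rw [hA', show (normalDilation S s : E → E) = (normalDilation S s : E →ₗ[ℝ] E) from rfl,
          Measure.addHaar_image_linearMap, det_normalDilation, hSn,
          abs_of_nonneg (by positivity), mul_assoc,
          ENNReal.ofReal_mul (p := c₁ * Real.exp (-(B * L ^ 2 * η ^ 2))) (by positivity),
          mul_comm v, ENNReal.ofReal_mul (p := s ^ (Module.finrank ℝ E - n)) (by positivity),
          ENNReal.ofReal_toReal hvtop]
    _ = ∫⁻ _ in A', ENNReal.ofReal (c₁ * Real.exp (-(B * L ^ 2 * η ^ 2))) := by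
        rw [setLIntegral_const]
    _ ≤ ∫⁻ y in A', ENNReal.ofReal |(fderiv ℝ φ.symm y).det| *
          ENNReal.ofReal (Real.exp (-(g (φ.symm y) / s ^ 2))) := by
        refine lintegral_mono_ae ?_
        filter_upwards [ae_restrict_mem hA'm] with y hy
        rw [ENNReal.ofReal_mul hc₁.le]
        exact mul_le_mul' (ENNReal.ofReal_le_ofReal (hdet y (hηr (hA'A hy))).1)
          (ENNReal.ofReal_le_ofReal (hval y hy))
    _ = ∫⁻ x in φ.symm '' A', ENNReal.ofReal (Real.exp (-(g x / s ^ 2))) :=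
        (lintegral_image_eq_lintegral_abs_det_fderiv_mul volume hA'm
          (fun y hy => (((hφs.of_le hk).differentiableOn (by simp)).differentiableAt
            (φ.open_target.mem_nhds (hrt (hηr (hA'A hy))))).hasFDerivAt.hasFDerivWithinAt)
          (φ.symm.injOn.mono fun y hy => hrt (hηr (hA'A hy)))
          fun x => ENNReal.ofReal (Real.exp (-(g x / s ^ 2)))).symm
    _ ≤ _ := by
        refine lintegral_mono_set ?_
        rintro _ ⟨y, hy, rfl⟩
        exact (hρN (hηW y (hA'A hy)).2).2.1

end

/-! ### The prefactor -/

lemma TendstoInCk.tendstoUniformlyOn {E : Type*} [NormedAddCommGroup E]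
    [InnerProductSpace ℝ E] {k : ℕ} {T : Set E} {c : ℝ → E → ℝ} {c₀ : E → ℝ}
    (h : TendstoInCk k T c c₀) : TendstoUniformlyOn c c₀ (𝓝[>] 0) T := by
  have h0 := h.2.2 0 (Nat.zero_le k)
  rw [Metric.tendstoUniformlyOn_iff] at h0 ⊢
  intro η hη
  filter_upwards [h0 η hη] with θ hθ x hx
  have := hθ x hx
  rwa [iteratedFDeriv_zero_eq_comp, iteratedFDeriv_zero_eq_comp, Function.comp_apply,
    Function.comp_apply, LinearIsometryEquiv.dist_map] at this

section

variable {E : Type*} [NormedAddCommGroup E] [InnerProductSpace ℝ E] [FiniteDimensional ℝ E]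

lemma fderiv_gradient_comm {f g : E → ℝ} (x : E) :
    fderiv ℝ f x (∇ g x) = fderiv ℝ g x (∇ f x) := by
  rw [← inner_gradient_eq_fderiv, ← inner_gradient_eq_fderiv, real_inner_comm]

lemma TendstoInCk.tendstoUniformlyOn_gradient {k : ℕ} (hk : 1 ≤ k) {T : Set E} {c : ℝ → E → ℝ}
    {c₀ : E → ℝ} (h : TendstoInCk k T c c₀) :
    TendstoUniformlyOn (fun θ => ∇ (c θ)) (∇ c₀) (𝓝[>] 0) T := by
  have h1 := h.2.2 1 hk
  have hcurry : ∀ (f : E → ℝ) (x : E),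
      continuousMultilinearCurryFin1 ℝ E ℝ (iteratedFDeriv ℝ 1 f x) = fderiv ℝ f x := fun f x => by
    ext v
    simp [iteratedFDeriv_one_apply]
  rw [Metric.tendstoUniformlyOn_iff] at h1 ⊢
  intro η hη
  filter_upwards [h1 η hη] with θ hθ x hx
  have := hθ x hx
  rwa [← (continuousMultilinearCurryFin1 ℝ E ℝ).dist_map, hcurry, hcurry,
    ← (InnerProductSpace.toDual ℝ E).symm.dist_map] at this

variable [MeasurableSpace E] [BorelSpace E] {M : Set E} {n : ℕ} {ε : ℝ}

/-- Concentration at `M`. If the exponent is `f` up to a constant, so that the flux is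
`θ exp(-f/θ) R θ` up to a factor, and if the limit of `R θ` is `-c₀ ∇ h` with `∇ h` orthogonal to
`∇ f`, then testing the flux against a cut-off of `h` by a function of `f` shows that the averages
of `c₀ ‖∇ h‖²` for the weights `exp(-f/θ)` tend to `0`. The Laplace bounds turn this into `∇ h = 0`
on `M`. -/
lemma IsDivergenceFreeFlux.fderiv_eq_zero {k : WithTop ℕ∞} (hk : 1 ≤ k)
    (hM : IsEmbeddedSubmanifold k n M) (hMc : IsCompact M) (hε : 0 < ε)
    {V f h c₀ : E → ℝ} {X : E → E} {c : ℝ → E → ℝ} {R : ℝ → E → E} {R₀ : E → E}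
    (hflux : IsDivergenceFreeFlux (Metric.thickening ε M) V X c c₀ R R₀)
    (hf : ContDiffOn ℝ 2 f (Metric.thickening ε M))
    (hh : ContDiffOn ℝ 1 h (Metric.thickening ε M)) {m a lam : ℝ} (hlam : 0 < lam)
    (hfm : ∀ p ∈ M, f p = m) (hf1 : ∀ p ∈ M, fderiv ℝ f p = 0)
    (hgrow : ∀ x ∈ Metric.thickening ε M, lam * Metric.infDist x M ^ 2 ≤ f x - m)
    (hV : ∀ x ∈ Metric.thickening ε M, V x = f x + a)
    (hX : ∀ x ∈ Metric.thickening ε M, X x = 0)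
    (hc₀ : ∀ x ∈ Metric.thickening ε M, 0 < c₀ x)
    (hR₀ : ∀ x ∈ Metric.thickening ε M, R₀ x = -(c₀ x • ∇ h x))
    (horth : ∀ x ∈ Metric.thickening ε M, fderiv ℝ f x (∇ h x) = 0) :
    ∀ p ∈ M, fderiv ℝ h p = 0 := by
  intro p hp
  by_contra hne0
  have hne : M.Nonempty := ⟨p, hp⟩
  set T := Metric.thickening ε M with hTdef
  have hT : IsOpen T := Metric.isOpen_thickening
  have hpT : p ∈ T := mem_thickening_of_mem hε hp
  set δ := ε / 2 with hδ
  have hδ0 : 0 < δ := by positivity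
  set K := Metric.cthickening δ M with hKdef
  have hK : IsCompact K := hMc.cthickening
  have hKT : K ⊆ T := Metric.cthickening_subset_thickening' hε (by rw [hδ]; linarith) M
  set ρ := lam * δ ^ 2 with hρ
  have hρ0 : 0 < ρ := by positivity
  set g : E → ℝ := fun x => f x - m with hg
  have hgC : ContDiffOn ℝ 2 g T := hf.sub contDiffOn_const
  have hgc : ContinuousOn g T := hgC.continuousOn
  have hg0 : ∀ x ∈ T, 0 ≤ g x := fun x hx => le_trans (by positivity) (hgrow x hx)
  -- the cut-off `χ ∘ g` is supported in `K` since `g ≥ ρ` outside of it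
  set χ : ℝ → ℝ := fun t => Real.smoothTransition (2 - 2 * t / ρ) with hχ
  have hχC : ContDiff ℝ 1 χ := Real.smoothTransition.contDiff.comp (by fun_prop)
  have hχ0 : ∀ t, 0 ≤ χ t := fun t => Real.smoothTransition.nonneg _
  have hχz : ∀ t, ρ ≤ t → χ t = 0 := fun t ht => by
    refine Real.smoothTransition.zero_of_nonpos ?_
    rw [sub_nonpos, le_div_iff₀ hρ0]; linarith
  have hχ1 : χ 0 = 1 := Real.smoothTransition.one_of_one_le (by norm_num)
  have hgK : ∀ x ∈ T, x ∉ K → χ (g x) = 0 := by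
    intro x hx hxK
    refine hχz _ (le_trans ?_ (hgrow x hx))
    rw [hKdef, mem_cthickening_iff_infDist_le hne hδ0.le, not_le] at hxK
    simp only [hρ]
    gcongr
  set φ : E → ℝ := T.indicator fun x => χ (g x) * h x with hφ
  have hφT : ∀ x ∈ T, φ =ᶠ[𝓝 x] fun x => χ (g x) * h x := fun x hx => by
    filter_upwards [hT.mem_nhds hx] with y hy using Set.indicator_of_mem hy _
  have hφK : ∀ x ∉ K, φ x = 0 := fun x hx => by
    by_cases hxT : x ∈ T
    · rw [hφ, Set.indicator_of_mem hxT, hgK x hxT hx, zero_mul]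
    · exact Set.indicator_of_notMem hxT _
  have hts : tsupport φ ⊆ K := closure_minimal (fun x hx => by
    by_contra hxK; exact hx (hφK x hxK)) hK.isClosed
  have hφc : HasCompactSupport φ := hK.of_isClosed_subset (isClosed_tsupport φ) hts
  have hφC : ContDiff ℝ 1 φ := by
    rw [contDiff_iff_contDiffAt]
    intro x
    by_cases hx : x ∈ T
    · exact ((hχC.contDiffAt.comp x ((hgC.of_le (by norm_num)).contDiffAt (hT.mem_nhds hx))).mul
        (hh.contDiffAt (hT.mem_nhds hx))).congr_of_eventuallyEq (hφT x hx)
    · refine (contDiffAt_const (c := (0 : ℝ))).congr_of_eventuallyEq ?_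
      filter_upwards [hK.isClosed.isOpen_compl.mem_nhds fun h => hx (hKT h)] with y hy
      exact hφK y hy
  have hφd : ∀ x ∉ K, fderiv ℝ φ x = 0 := fun x hx =>
    fderiv_eq_zero_of_notMem_tsupport fun h => hx (hts h)
  have hφdc : Continuous (fderiv ℝ φ) := hφC.continuous_fderiv (by simp)
  set W : E → ℝ := fun x => c₀ x * χ (g x) * ‖∇ h x‖ ^ 2 with hW
  have hWc : ContinuousOn W T := (hflux.prefactor.mul (hχC.continuous.comp_continuousOn hgc)).mul
    ((continuousOn_gradient hT hh).norm.pow 2)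
  have hW0 : ∀ x ∈ T, 0 ≤ W x := fun x hx =>
    mul_nonneg (mul_nonneg (hc₀ x hx).le (hχ0 _)) (sq_nonneg _)
  have hφR : ∀ x ∈ T, fderiv ℝ φ x (R₀ x) = -W x := by
    intro x hx
    have dg : HasFDerivAt g (fderiv ℝ f x) x :=
      ((hf.differentiableOn (by simp)).differentiableAt (hT.mem_nhds hx)).hasFDerivAt.sub_const m
    have dh := ((hh.differentiableOn (by simp)).differentiableAt (hT.mem_nhds hx)).hasFDerivAt
    have dχ := ((hχC.differentiable (by simp)).differentiableAt (x := g x)).hasDerivAt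
    have d := ((dχ.comp_hasFDerivAt x dg).mul dh).congr_of_eventuallyEq (hφT x hx)
    have hself : fderiv ℝ h x (∇ h x) = ‖∇ h x‖ ^ 2 := by
      rw [← inner_gradient_eq_fderiv, real_inner_self_eq_norm_sq]
    rw [d.fderiv, hR₀ x hx]
    simp only [add_apply, smul_apply, map_neg, map_smul, horth x hx, hself, hW, Function.comp_apply,
      smul_eq_mul]
    ring
  -- a ball around `p` on which `W` is bounded below
  have hWp : 0 < W p := by
    have h1 : 0 < ‖∇ h p‖ := norm_pos_iff.2 fun h0 => hne0 (by
      simpa [gradient] using h0)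
    have h2 : g p = 0 := by simp [hg, hfm p hp]
    simp only [hW, h2, hχ1, mul_one]
    have := hc₀ p hpT
    positivity
  obtain ⟨r, hr, hrW⟩ := Metric.mem_nhds_iff.1 (inter_mem
    ((hWc.continuousAt (hT.mem_nhds hpT)).eventually (lt_mem_nhds (half_lt_self hWp)))
    (Metric.ball_mem_nhds p hδ0))
  have hrK : Metric.ball p r ⊆ K := fun x hx =>
    Metric.thickening_subset_cthickening _ _ (Metric.mem_thickening_iff.2 ⟨p, hp, (hrW hx).2⟩)
  obtain ⟨C, hC, hCs⟩ := exists_lintegral_exp_neg_le hk hM hMc hne hK hT hKT hlam hgrow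
  obtain ⟨κ, hκ, hκs⟩ := exists_le_lintegral_exp_neg hk hM hp (g := g)
    (hgC.contDiffAt (hT.mem_nhds hpT)) (fun q hq => by simp [hg, hfm q hq])
    (fun q hq => by rw [hg, fderiv_sub_const, hf1 q hq]) hr
  obtain ⟨D, hD⟩ := hK.exists_bound_of_continuousOn hφdc.continuousOn
  have hD0 : 0 ≤ D := (norm_nonneg _).trans (hD p (hrK (Metric.mem_ball_self hr)))
  -- chosen so that the upper bound `η D C S` on the average of `W` is below the lower bound
  -- `W p / 2 * κ S`, where `S` is the power of `s` in the Laplace bounds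
  set η := W p / 2 * κ / (2 * (D * C + 1)) with hη
  have hη0 : 0 < η := by positivity
  obtain ⟨n1, -⟩ := tendsto_setIntegral_clm_apply hT hK hKT (A := fun x => fderiv ℝ φ x)
    hφdc.continuousOn hφd hflux.remainder (hflux.remainder_tendsto K hKT hK) hflux.remainder_meas
  obtain ⟨θ, hθf, hθi, hθR, hθ0, hθ1⟩ := (hflux.flux.and (n1.and
    ((Metric.tendstoUniformlyOn_iff.1 (hflux.remainder_tendsto K hKT hK) η hη0).and
      (Ioo_mem_nhdsGT (zero_lt_one' ℝ))))).exists
  set s := √θ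
  have hs0 : 0 < s := Real.sqrt_pos.2 hθ0
  have hs : s ∈ Set.Ioc (0 : ℝ) 1 := ⟨hs0, Real.sqrt_le_one.2 hθ1.le⟩
  have hs2 : s ^ 2 = θ := Real.sq_sqrt hθ0.le
  set w : E → ℝ := fun x => Real.exp (-(g x / s ^ 2)) with hw
  have hwc : ContinuousOn w T := (hgc.div_const _).neg.rexp
  have hw0 : ∀ x, 0 < w x := fun x => Real.exp_pos _
  have hwi : IntegrableOn w K := (hwc.mono hKT).integrableOn_compact hK
  have hWi : IntegrableOn (fun x => w x * W x) K :=
    ((hwc.mul hWc).mono hKT).integrableOn_compact hK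
  have hFi : IntegrableOn (fun x => w x * fderiv ℝ φ x (R θ x)) K :=
    (hθi.mono_set hKT).continuousOn_mul (hwc.mono hKT) hK
  -- the flux identity, freed of constant factors
  have hzero : ∫ x in K, w x * fderiv ℝ φ x (R θ x) = 0 := by
    have h1 := hθf φ hφC hφc (hts.trans hKT)
    have h2 : ∀ x ∈ T, fderiv ℝ φ x (Real.exp (-V x / θ) • (c θ x • X x + θ • R θ x)) =
        (Real.exp (-(m + a) / θ) * θ) * (w x * fderiv ℝ φ x (R θ x)) := by
      intro x hx
      have h3 : Real.exp (-V x / θ) = Real.exp (-(m + a) / θ) * w x := by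
        simp only [hw, hg, hs2]
        rw [← Real.exp_add, hV x hx]
        congr 1
        ring
      rw [hX x hx, h3, smul_zero, zero_add, map_smul, map_smul, smul_eq_mul, smul_eq_mul]
      ring
    rw [setIntegral_congr_fun hT.measurableSet h2, integral_const_mul] at h1
    have h4 := (mul_eq_zero.1 h1).resolve_left (by positivity)
    rw [← h4]
    exact (setIntegral_eq_of_subset_of_forall_sdiff_eq_zero hT.measurableSet hKT
      fun x hx => by rw [hφd x hx.2]; simp).symm
  have hupper : ∫ x in K, w x * W x ≤ η * D * ∫ x in K, w x := by
    have h1 : ∫ x in K, w x * W x ≤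
        ∫ x in K, (η * D * w x - w x * fderiv ℝ φ x (R θ x)) := by
      refine setIntegral_mono_on hWi ((hwi.const_mul _).sub hFi) hK.measurableSet fun x hx => ?_
      have h2 : |fderiv ℝ φ x (R θ x - R₀ x)| ≤ D * η := by
        refine ((fderiv ℝ φ x).le_opNorm _).trans
          (mul_le_mul (hD x hx) ?_ (norm_nonneg _) hD0)
        rw [← dist_eq_norm, dist_comm]
        exact (hθR x hx).le
      rw [map_sub, hφR x (hKT hx), sub_neg_eq_add] at h2
      have h3 := mul_le_mul_of_nonneg_left ((le_abs_self _).trans h2) (hw0 x).le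
      linarith
    rwa [integral_sub (hwi.const_mul _) hFi, hzero, sub_zero, integral_const_mul] at h1
  have hlower : W p / 2 * ∫ x in Metric.ball p r, w x ≤ ∫ x in K, w x * W x := by
    rw [← integral_const_mul]
    refine le_trans ?_ (setIntegral_mono_set hWi ?_ (LE.le.eventuallyLE hrK))
    · refine setIntegral_mono_on ((hwi.mono_set hrK).const_mul _) (hWi.mono_set hrK)
        measurableSet_ball fun x hx => ?_
      rw [mul_comm]
      exact mul_le_mul_of_nonneg_left (hrW hx).1.le (hw0 x).le
    · filter_upwards [ae_restrict_mem hK.measurableSet] with x hx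
      exact mul_nonneg (hw0 x).le (hW0 x (hKT hx))
  set S := s ^ (Module.finrank ℝ E - n)
  have hS : 0 < S := by positivity
  have e1 : ∫ x in K, w x ≤ C * S := by
    refine (ENNReal.ofReal_le_ofReal_iff (by positivity)).1 ?_
    rw [ofReal_integral_eq_lintegral_ofReal hwi (ae_of_all _ fun x => (hw0 x).le)]
    exact hCs s hs
  have e2 : κ * S ≤ ∫ x in Metric.ball p r, w x := by
    refine (ENNReal.ofReal_le_ofReal_iff (integral_nonneg fun x => (hw0 x).le)).1 ?_
    rw [ofReal_integral_eq_lintegral_ofReal (hwi.mono_set hrK) (ae_of_all _ fun x => (hw0 x).le)]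
    exact hκs s hs
  have e3 : W p / 2 * (κ * S) ≤ η * D * (C * S) :=
    (mul_le_mul_of_nonneg_left e2 (by positivity)).trans
      (hlower.trans (hupper.trans (mul_le_mul_of_nonneg_left e1 (by positivity))))
  have e4 : W p / 2 * κ ≤ η * (D * C) := by
    refine le_of_mul_le_mul_right ?_ hS
    linarith
  have e5 : η * (2 * (D * C + 1)) = W p / 2 * κ := div_mul_cancel₀ _ (by positivity)
  nlinarith [mul_nonneg hD0 hC]

end

/-- Stationarity of a density of WKB form, together with the expansion of the drift, gives a
divergence free flux whose leading field is `∇ (V - f₀)` and whose next order is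
`-(c₀ ∇ f₁ + ∇ c₀)`. -/
lemma isDivergenceFreeFlux {d : ℕ} {T : Set (EuclideanSpace ℝ (Fin d))} (hT : IsOpen T) {θ₀ : ℝ}
    (hθ₀ : 0 < θ₀) {f₀ f₁ V c₀ : EuclideanSpace ℝ (Fin d) → ℝ}
    {b : ℝ → EuclideanSpace ℝ (Fin d) → EuclideanSpace ℝ (Fin d)}
    {p c : ℝ → EuclideanSpace ℝ (Fin d) → ℝ}
    (hf₀ : ContDiffOn ℝ 1 f₀ T) (hf₁ : ContDiffOn ℝ 1 f₁ T) (hV : ContDiffOn ℝ 1 V T)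
    (hbmeas : ∀ θ ∈ Set.Ioo 0 θ₀, Measurable (b θ))
    (hbloc : ∀ θ ∈ Set.Ioo 0 θ₀, ∀ R : ℝ, ∃ B : ℝ, ∀ x, ‖x‖ ≤ R → ‖b θ x‖ ≤ B)
    (hb : ∀ η > 0, ∀ᶠ θ in 𝓝[>] (0 : ℝ), ∀ x ∈ T, ‖b θ x - (-∇ f₀ x - θ • ∇ f₁ x)‖ ≤ η * θ)
    (hp : ∀ θ ∈ Set.Ioo 0 θ₀, IsStationaryDensity (fun x => θ⁻¹ • b θ x) (p θ))
    {k : ℕ} (hk : 1 ≤ k) (hc : TendstoInCk k T c c₀)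
    (hform : ∀ᶠ θ in 𝓝[>] (0 : ℝ), ∃ Z : ℝ, 0 < Z ∧
      ∀ x ∈ T, p θ x = Z * (Real.exp (-V x / θ) * c θ x)) :
    IsDivergenceFreeFlux T V (∇ fun x => V x - f₀ x) c c₀
      (fun θ x => (θ⁻¹ * c θ x) • (b θ x + ∇ f₀ x) - ∇ (c θ) x)
      (fun x => -(c₀ x • ∇ f₁ x) - ∇ c₀ x) := by
  have hk' : ((1 : ℕ∞) : WithTop ℕ∞) ≤ (k : WithTop ℕ∞) := by exact_mod_cast hk
  have hc₀ : ContDiffOn ℝ 1 c₀ T := hc.2.1.of_le hk'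
  have hcθ : ∀ᶠ θ in 𝓝[>] (0 : ℝ), ContDiffOn ℝ 1 (c θ) T := hc.1.mono fun θ h => h.of_le hk'
  have hsmall : ∀ᶠ θ in 𝓝[>] (0 : ℝ), θ ∈ Set.Ioo 0 θ₀ := Ioo_mem_nhdsGT hθ₀
  have hgf₁ := continuousOn_gradient hT hf₁
  refine ⟨hT, hV, continuousOn_gradient hT (hV.sub hf₀),
    hc₀.continuousOn, (hc₀.continuousOn.smul hgf₁).neg.sub (continuousOn_gradient hT hc₀),
    fun K hKT _ => hc.tendstoUniformlyOn.mono hKT, fun K hKT hK => ?_, ?_, ?_, ?_⟩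
  · refine TendstoUniformlyOn.sub ?_ ((hc.tendstoUniformlyOn_gradient hk).mono hKT)
    obtain ⟨A, hA⟩ := hK.exists_bound_of_continuousOn (hc₀.continuousOn.mono hKT)
    obtain ⟨B, hB⟩ := hK.exists_bound_of_continuousOn (hgf₁.mono hKT)
    rw [Metric.tendstoUniformlyOn_iff]
    intro ζ hζ
    -- the difference is `c θ (θ⁻¹ (b θ + ∇ f₀) + ∇ f₁) + (c₀ - c θ) ∇ f₁`
    set η := ζ / (2 * (|A| + |B| + 1)) with hη
    have hη0 : 0 < η := by positivity
    have hηe : η * (2 * (|A| + |B| + 1)) = ζ := div_mul_cancel₀ _ (by positivity)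
    filter_upwards [hb η hη0, hsmall,
      Metric.tendstoUniformlyOn_iff.1 hc.tendstoUniformlyOn η hη0,
      Metric.tendstoUniformlyOn_iff.1 hc.tendstoUniformlyOn 1 one_pos] with θ h1 h2 h3 h4 x hx
    have hθ := h2.1
    have e1 : -(c₀ x • ∇ f₁ x) - (θ⁻¹ * c θ x) • (b θ x + ∇ f₀ x) =
        -((c₀ x - c θ x) • ∇ f₁ x) -
          (θ⁻¹ * c θ x) • (b θ x - (-∇ f₀ x - θ • ∇ f₁ x)) := by
      have : (θ⁻¹ * c θ x) • θ • ∇ f₁ x = c θ x • ∇ f₁ x := by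
        rw [smul_smul]; congr 1; field_simp
      simp only [smul_sub, smul_add, smul_neg, this, sub_smul]
      abel
    rw [dist_eq_norm, e1]
    have b1 : ‖(c₀ x - c θ x) • ∇ f₁ x‖ ≤ η * |B| := by
      rw [norm_smul, ← dist_eq_norm]
      exact mul_le_mul (h3 x (hKT hx)).le ((hB x hx).trans (le_abs_self B)) (norm_nonneg _) hη0.le
    have b2 : |c θ x| ≤ |A| + 1 := by
      have e2 := (h4 x (hKT hx)).le
      rw [dist_comm, Real.dist_eq] at e2
      have e3 := abs_add_le (c θ x - c₀ x) (c₀ x)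
      rw [sub_add_cancel] at e3
      have e4 := (hA x hx).trans (le_abs_self A)
      rw [Real.norm_eq_abs] at e4
      linarith
    have b3 : ‖(θ⁻¹ * c θ x) • (b θ x - (-∇ f₀ x - θ • ∇ f₁ x))‖ ≤ (|A| + 1) * η := by
      rw [norm_smul, norm_mul, Real.norm_of_nonneg (inv_pos.2 hθ).le, Real.norm_eq_abs]
      calc _ ≤ θ⁻¹ * (|A| + 1) * (η * θ) := by
            gcongr
            exact h1 x (hKT hx)
        _ = _ := by field_simp
    refine (norm_sub_le _ _).trans_lt ?_
    rw [norm_neg]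
    nlinarith [abs_nonneg A, abs_nonneg B]
  · filter_upwards [hcθ] with θ h using h.continuousOn.aestronglyMeasurable hT.measurableSet
  · filter_upwards [hcθ, hsmall] with θ h h2
    have m1 := h.continuousOn.aestronglyMeasurable (μ := volume) hT.measurableSet
    have m2 := (continuousOn_gradient hT h).aestronglyMeasurable (μ := volume) hT.measurableSet
    have m3 := (continuousOn_gradient hT hf₀).aestronglyMeasurable (μ := volume) hT.measurableSet
    exact ((m1.const_mul _).smul ((hbmeas θ h2).aestronglyMeasurable.add m3)).sub m2
  · filter_upwards [hcθ, hsmall, hform] with θ h h2 ⟨Z, hZ, hpZ⟩ g hg hgc hgT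
    have hθ := h2.1
    rw [← setIntegral_fderiv_flux_eq_zero hT hθ hZ hV h (hbmeas θ h2) (hbloc θ h2) (hp θ h2) hpZ
      hg hgc hgT]
    refine setIntegral_congr_fun hT.measurableSet fun x hx => ?_
    have e1 : ∇ (fun x => V x - f₀ x) x = ∇ V x - ∇ f₀ x := by
      have dV := (hV.differentiableOn (by simp)).differentiableAt (hT.mem_nhds hx)
      have df := (hf₀.differentiableOn (by simp)).differentiableAt (hT.mem_nhds hx)
      simp only [gradient, fderiv_fun_sub dV df, map_sub]
    have e2 : θ • (θ⁻¹ * c θ x) • (b θ x + ∇ f₀ x) = c θ x • (b θ x + ∇ f₀ x) := by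
      rw [smul_smul]; congr 1; field_simp
    simp only [smul_sub θ, e1, e2]
    congr 2
    module

end

/-! ### The exponent and the prefactor -/

theorem mainTheorem5 {d n : ℕ} (M : Set (EuclideanSpace ℝ (Fin d))) (ε θ₀ : ℝ)
    (f₀ f₁ V c₀ : EuclideanSpace ℝ (Fin d) → ℝ)
    (b : ℝ → EuclideanSpace ℝ (Fin d) → EuclideanSpace ℝ (Fin d))
    (p : ℝ → EuclideanSpace ℝ (Fin d) → ℝ)
    (hM : IsEmbeddedSubmanifold 4 n M) (hMcomp : IsCompact M) (hMconn : IsConnected M)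
    (hε : 0 < ε) (hθ₀ : 0 < θ₀)
    -- the leading part `f₀` and the correction `f₁` on the tube around `M`
    (hf₀ : ContDiffOn ℝ 3 f₀ (Metric.thickening ε M))
    (hf₁ : ContDiffOn ℝ 1 f₁ (Metric.thickening ε M))
    (hargmin : {x ∈ Metric.thickening ε M | IsMinOn f₀ (Metric.thickening ε M) x} = M)
    (hconv : UniformlyConvexInNormalDirections M ε f₀)
    -- the drift: `b θ = -∇ f₀ - θ ∇ f₁ + o(θ)`, uniformly on the tube
    (hbmeas : ∀ θ ∈ Set.Ioo 0 θ₀, Measurable (b θ))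
    (hbloc : ∀ θ ∈ Set.Ioo 0 θ₀, ∀ R : ℝ, ∃ B : ℝ, ∀ x, ‖x‖ ≤ R → ‖b θ x‖ ≤ B)
    (hb : ∀ η > 0, ∀ᶠ θ in 𝓝[>] (0 : ℝ), ∀ x ∈ Metric.thickening ε M,
      ‖b θ x - (-∇ f₀ x - θ • ∇ f₁ x)‖ ≤ η * θ)
    -- `p θ` is a stationary density of `dx = (b θ x / θ) dt + √2 dW`
    (hp : ∀ θ ∈ Set.Ioo 0 θ₀, IsStationaryDensity (fun x => θ⁻¹ • b θ x) (p θ))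
    (hWKB : HasLocalWKBForm (Metric.thickening ε M) p V c₀) :
    (∃ a : ℝ, ∀ x ∈ Metric.thickening ε M, V x = f₀ x + a) ∧
    (∃ C : ℝ, 0 < C ∧ ∀ x ∈ Metric.thickening ε M, c₀ x = C * Real.exp (-f₁ x)) := by 
  set T := Metric.thickening ε M with hTdef
  have hT : IsOpen T := Metric.isOpen_thickening
  have hne : M.Nonempty := hMconn.nonempty
  obtain ⟨lam, hlam, hcv⟩ := hconv
  obtain ⟨c, hc, hform⟩ := hWKB.form
  have hpos := hWKB.prefactor_pos
  have hV2 : ContDiffOn ℝ 2 V T := hWKB.exponent.of_le (by norm_num)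
  have hf2 : ContDiffOn ℝ 2 f₀ T := hf₀.of_le (by norm_num)
  have hU2 : ContDiffOn ℝ 2 (fun x => V x - f₀ x) T := hV2.sub hf2
  have hc₀ : ContDiffOn ℝ 1 c₀ T := hc.2.1.of_le (by norm_num)
  have hVd : ∀ x ∈ T, DifferentiableAt ℝ V x := fun x hx =>
    (hV2.differentiableOn (by simp)).differentiableAt (hT.mem_nhds hx)
  have hfd : ∀ x ∈ T, DifferentiableAt ℝ f₀ x := fun x hx =>
    (hf2.differentiableOn (by simp)).differentiableAt (hT.mem_nhds hx)
  have hMT : ∀ x ∈ M, x ∈ T := fun x hx => mem_thickening_of_mem hε hx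
  -- `M` consists of minima of `f₀`
  have hmin : ∀ x ∈ M, IsMinOn f₀ T x := fun x hx => by
    rw [← hargmin] at hx
    exact hx.2
  have hloc : ∀ x ∈ M, IsLocalMin f₀ x := fun x hx =>
    (hmin x hx).isLocalMin (hT.mem_nhds (hMT x hx))
  have hf1 : ∀ x ∈ M, fderiv ℝ f₀ x = 0 := fun x hx => (hloc x hx).fderiv_eq_zero
  obtain ⟨p₀, hp₀⟩ := hne
  have hne : M.Nonempty := ⟨p₀, hp₀⟩
  have hfm : ∀ x ∈ M, f₀ x = f₀ p₀ := fun x hx =>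
    le_antisymm (isMinOn_iff.1 (hmin x hx) p₀ (hMT p₀ hp₀))
      (isMinOn_iff.1 (hmin p₀ hp₀) x (hMT x hx))
  have hrad : ∀ x ∈ T, ∀ q ∈ M, (∀ q' ∈ M, dist x q ≤ dist x q') →
      lam * ‖x - q‖ ^ 2 ≤ fderiv ℝ f₀ x (x - q) := fun x hx q hq hq' => by
    have := le_fderiv_of_normal hf2 hcv hq (hf1 q hq) (sub_mem_normalSpaceAt hq')
      (dist_lt_of_mem_thickening hx hq')
    rwa [add_sub_cancel] at this
  have hgrow : ∀ x ∈ T, lam / 2 * Metric.infDist x M ^ 2 ≤ f₀ x - f₀ p₀ := fun x hx => by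
    obtain ⟨q, hq, hq', hd⟩ := exists_nearest hMcomp hne x
    have := le_sub_of_normal hf2 hcv hq (hf1 q hq) (sub_mem_normalSpaceAt hq')
      (dist_lt_of_mem_thickening hx hq')
    rwa [add_sub_cancel, hfm q hq, ← dist_eq_norm, ← hd] at this
  -- the eikonal and transport equations
  have hflux := isDivergenceFreeFlux hT hθ₀ (hf₀.of_le (by norm_num)) hf₁
    (hV2.of_le (by norm_num)) hbmeas hbloc hb hp one_le_two hc hform
  have heik := hflux.eikonal hpos
  have htrans := hflux.transport hpos hU2 hc₀
  have hjet : ∀ x ∈ M, fderiv ℝ V x = 0 ∧ fderiv ℝ (fun y => V y - f₀ y) x = 0 ∧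
      fderiv ℝ (fderiv ℝ fun y => V y - f₀ y) x = 0 := fun x hx => by
    obtain ⟨h1, h2, h3⟩ := fderiv_eq_zero_of_eikonal hT hf2 hV2 heik (hMT x hx) (hloc x hx)
    refine ⟨h1, h2, h3 ?_⟩
    have h4 := htrans x (hMT x hx)
    have h5 : ∇ (fun y => V y - f₀ y) x = 0 := by rw [gradient, h2, map_zero]
    rw [h1, h5] at h4
    simpa [(hpos x (hMT x hx)).ne'] using h4
  obtain ⟨a, ha⟩ := exists_eq_const_of_fderiv_eq_zero (k := 4) (by norm_num) hM hMconn
    (F := fun y => V y - f₀ y) (fun x hx => (hVd x (hMT x hx)).sub (hfd x (hMT x hx)))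
    fun x hx => (hjet x hx).2.1
  have hVa : ∀ x ∈ T, V x = f₀ x + a := fun x hx => by
    have := eq_const_of_eikonal hMcomp hne hε hf2 hV2 hlam hrad
      (fun x hx => by rw [fderiv_gradient_comm]; exact heik x hx) (fun x hx => (hjet x hx).2.1)
      (fun x hx => (hjet x hx).2.2) ha x hx
    linarith
  refine ⟨⟨a, hVa⟩, ?_⟩
  -- with `∇ V = ∇ f₀` the transport equation says that `log c₀ + f₁` is constant along `∇ f₀`
  have hUa : ∀ x ∈ T, (fun y => V y - f₀ y) =ᶠ[𝓝 x] fun _ => a := fun x hx => by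
    filter_upwards [hT.mem_nhds hx] with y hy
    rw [hVa y hy]; ring
  have hgU0 : ∀ x ∈ T, ∇ (fun y => V y - f₀ y) x = 0 := fun x hx => by
    rw [gradient, (hUa x hx).fderiv_eq]; simp
  have hVf : ∀ x ∈ T, fderiv ℝ V x = fderiv ℝ f₀ x := fun x hx => by
    have : V =ᶠ[𝓝 x] fun y => f₀ y + a := by
      filter_upwards [hT.mem_nhds hx] with y hy using hVa y hy
    rw [this.fderiv_eq, fderiv_add_const]
  set h : EuclideanSpace ℝ (Fin d) → ℝ := fun x => Real.log (c₀ x) + f₁ x with hdef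
  have hh : ContDiffOn ℝ 1 h T := (hc₀.log fun x hx => (hpos x hx).ne').add hf₁
  have hgh : ∀ x ∈ T, -(c₀ x • ∇ f₁ x) - ∇ c₀ x = -(c₀ x • ∇ h x) := fun x hx => by
    have d1 := (hc₀.differentiableOn (by simp)).differentiableAt (hT.mem_nhds hx)
    have d2 := (hf₁.differentiableOn (by simp)).differentiableAt (hT.mem_nhds hx)
    have d : HasFDerivAt h _ x := (d1.hasFDerivAt.log (hpos x hx).ne').add d2.hasFDerivAt
    have hx0 := (hpos x hx).ne'
    simp only [gradient, d.fderiv, map_add, map_smul, smul_add, smul_smul, mul_inv_cancel₀ hx0,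
      one_smul]
    abel
  have horth : ∀ x ∈ T, fderiv ℝ f₀ x (∇ h x) = 0 := fun x hx => by
    have h1 := htrans x hx
    have h2 : Laplacian.laplacian (fun y => V y - f₀ y) x = 0 := by
      rw [Filter.EventuallyEq.eq_of_nhds (InnerProductSpace.laplacian_congr_nhds (hUa x hx))]
      simp
    rw [hgU0 x hx, h2, hgh x hx, hVf x hx] at h1
    simpa [(hpos x hx).ne'] using h1
  have hh0 := hflux.fderiv_eq_zero (k := 4) (by norm_num) hM hMcomp hε hf2 hh
    (half_pos hlam) hfm hf1 hgrow hVa hgU0 hpos hgh horth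
  have hhd : ∀ x ∈ T, DifferentiableAt ℝ h x := fun x hx =>
    (hh.differentiableOn (by simp)).differentiableAt (hT.mem_nhds hx)
  obtain ⟨K, hK⟩ := exists_eq_const_of_fderiv_eq_zero (k := 4) (by norm_num) hM hMconn
    (fun x hx => hhd x (hMT x hx)) hh0
  refine ⟨Real.exp K, Real.exp_pos K, fun x hx => ?_⟩
  obtain ⟨q, hq, hq', hd⟩ := exists_nearest hMcomp hne x
  have hr : Metric.infDist x M < ε := by
    rw [hd, dist_eq_norm]
    exact dist_lt_of_mem_thickening hx hq'
  have hsub := Metric.cthickening_subset_thickening' hε hr M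
  have hhx : h x = K := eq_of_fderiv_gradient_eq_zero hMcomp hne Metric.infDist_nonneg
    (fun y hy => hfd y (hsub hy)) (fun y hy => hhd y (hsub hy))
    (fun y hy => by rw [fderiv_gradient_comm]; exact horth y (hsub hy))
    (fun y hy hyM q hq hq' => by
      refine lt_of_lt_of_le ?_ (hrad y (hsub hy) q hq hq')
      have : 0 < ‖y - q‖ := norm_pos_iff.2 fun h0 => hyM (by rwa [sub_eq_zero.1 h0])
      positivity) hK x
    ((mem_cthickening_iff_infDist_le hne Metric.infDist_nonneg).2 le_rfl)
  rw [← hhx, hdef, ← Real.exp_add, add_neg_cancel_right, Real.exp_log (hpos x hx)]
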